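/- Let $P$ be a nonempty finite set of processes and $\Sigma$ a nonempty finite set of labels. A *message sequence chart* (MSC) over $P$ and $\Sigma$ is a tuple $M=(E,\to,\vartriangleright,\mathrm{loc},\lambda)$ with a nonempty finite set $E$ of events, relations ${\to},{\vartriangleright}\subseteq E\times E$ and maps $\mathrm{loc}\colon E\to P$, $\lambda\colon E\to\Sigma$, such that, with $E_p=\mathrm{loc}^{-1}(p)$: every process edge $e\to f$ satisfies $\mathrm{loc}(e)=\mathrm{loc}(f)$, and for each $p$ the relation $\to$ restricted to $E_p$ is the direct-successor relation of some total order on $E_p$; every message edge $e\vartriangleright f$ satisfies $\mathrm{loc}(e)\ne\mathrm{loc}(f)$; each event belongs to at most one message edge; if $e\vartriangleright f$ and $e'\vartriangleright f'$ with $e,e'\in E_p$ and $f,f'\in E_q$, then $e\to^* e'$ if and only if $f\to^* f'$ (FIFO); and ${\to}\cup{\vartriangleright}$ is acyclic. The happened-before relation is ${\le}=({\to}\cup{\vartriangleright})^*$. Isomorphic MSCs are identified. MSO formulas are built from the atoms $p(x)$, $a(x)$, $x=y$, $x\to y$, $x\vartriangleright y$, $x\le y$, $x\in X$ (with $p\in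 P$, $a\in\Sigma$) by $\lor$, $\lnot$, $\exists x$ (over events) and $\exists X$ (over sets of events), with the usual semantics over MSCs. Formulas of $\mathrm{EMSO}[\to,\vartriangleright,\le]$ are those of the form $\exists X_1\dots\exists X_n.\varphi$ with $n\ge 0$ and $\varphi$ without second-order quantifiers. A sentence $\Phi$ (a formula without free variables) defines the language $\mathbb L(\Phi)$ of all MSCs that satisfy it. A *communicating finite-state machine* (CFM) consists of a finite set $\mathit{Msg}$; for each $p\in P$ a finite state set $S_p$, an initial state $\iota_p\in S_p$ and a set $\Delta_p$ of transitions $(s,\alpha,s')$ with $s,s'\in S_p$, where the action $\alpha$ is internal with a label $a\in\Sigma$, or sends $m\in\mathit{Msg}$ to some $q\ne p$ with a label $a$, or receives $m\in\mathit{Msg}$ from some $q\ne p$ with a label $a$; and an acceptance set $\mathit{Acc}\subseteq\prod_{p}S_p$. A run on an MSC assigns to each $e\in E_p$ a transition $\rho(e)\in\Delta_p$ with label $\lambda(e)$, such that the source of $\rho(e)$ is $\iota_p$ if $e$ has no $\to$-predecessor; the target of $\rho(e)$ is the source of $\rho(f)$ whenever $e\to f$; $\rho(e)$ is internal if $e$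 lies on no message edge; and if $e\vartriangleright f$, then for some $m$ the transition $\rho(e)$ sends $m$ to $\mathrm{loc}(f)$ and $\rho(f)$ receives $m$ from $\mathrm{loc}(e)$. The run is accepting if $(s_p)_{p\in P}\in\mathit{Acc}$, where $s_p$ is the target of $\rho(e)$ for the last event $e$ of $E_p$, and $s_p=\iota_p$ if $E_p=\emptyset$. The language $\mathbb L(\mathcal A)$ of a CFM $\mathcal A$ is the set of MSCs on which it has an accepting run. **Theorem.** $\{\mathbb L(\Phi)\mid \Phi\in\mathrm{EMSO}[\to,\vartriangleright,\le]\text{ is a sentence}\}=\{\mathbb L(\mathcal A)\mid\mathcal A\text{ is a CFM over }P\text{ and }\Sigma\}$. That is, a set of MSCs over $P$ and $\Sigma$ is definable by a sentence of existential MSO logic with the process, message and happened-before relations if and only if it is the language of a CFM over $P$ and $\Sigma$. -/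

import Mathlib

universe u

/-- A message sequence chart over the processes `P` and the labels `Sig`: finitely many events (and
at least one), with process edges `proc` and message edges `msg`. -/
structure MSC (P Sig : Type u) where
  /-- the events -/
  E : Type u
  finite_E : Finite E
  nonempty_E : Nonempty E
  /-- process edges -/
  proc : E → E → Prop
  /-- message edges -/
  msg : E → E → Prop
  /-- the process that executes an event -/
  loc : E → P
  /-- the label of an event -/
  lab : E → Sig
  /-- Process edges stay on one process. -/
  loc_eq_of_proc : ∀ e f, proc e f → loc e = loc f
  /-- On each process, the process edges form the direct-successor relation of a total order. -/
  proc_succ : ∀ p : P, ∃ _ : LinearOrder {e : E // loc e = p},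
    ∀ e f : {e : E // loc e = p}, proc e.1 f.1 ↔ e ⋖ f
  /-- Messages are sent between distinct processes. -/
  loc_ne_of_msg : ∀ e f, msg e f → loc e ≠ loc f
  /-- Each event is part of at most one message edge. -/
  msg_unique : ∀ e f e' f', msg e f → msg e' f' →
    (e = e' ∨ e = f' ∨ f = e' ∨ f = f') → e = e' ∧ f = f'
  /-- Each channel is first-in first-out. -/
  fifo : ∀ e f e' f', msg e f → msg e' f' → loc e = loc e' → loc f = loc f' →
    (Relation.ReflTransGen proc e e' ↔ Relation.ReflTransGen proc f f')
  /-- Process edges and message edges together form no cycle. -/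
  acyclic : ∀ e, ¬ Relation.TransGen (fun a b => proc a b ∨ msg a b) e e

namespace MSC

variable {P Sig : Type u}

/-- The happened-before relation: the reflexive transitive closure of the union of the process
edges and the message edges. -/
def le (M : MSC P Sig) (e f : M.E) : Prop :=
  Relation.ReflTransGen (fun a b => M.proc a b ∨ M.msg a b) e f

/-- The events located on process `p`. -/
abbrev Ev (M : MSC P Sig) (p : P) : Type u := {e : M.E // M.loc e = p}

/-- An event is internal if it is neither a send event nor a receive event. -/
def IsInternal (M : MSC P Sig) (e : M.E) : Prop :=
  ∀ f, ¬ M.msg e f ∧ ¬ M.msg f e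

end MSC

/-- Formulas of monadic second-order logic over message sequence charts. The first-order (event)
variables and the second-order (set) variables are two separate copies of `ℕ`. -/
inductive MSO (P Sig : Type u) : Type u where
  /-- `p(x)`: the event `x` is on process `p` -/
  | onProc (p : P) (x : ℕ)
  /-- `a(x)`: the event `x` has label `a` -/
  | hasLab (a : Sig) (x : ℕ)
  /-- `x = y` -/
  | eq (x y : ℕ)
  /-- there is a process edge from `x` to `y` -/
  | proc (x y : ℕ)
  /-- there is a message edge from `x` to `y` -/
  | msg (x y : ℕ)
  /-- `x ≤ y` for the happened-before relation -/
  | le (x y : ℕ)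
  /-- `x ∈ X` -/
  | mem (x X : ℕ)
  | or (φ ψ : MSO P Sig)
  | not (φ : MSO P Sig)
  /-- `∃ x. φ` for an event variable `x` -/
  | exEvent (x : ℕ) (φ : MSO P Sig)
  /-- `∃ X. φ` for a set variable `X` -/
  | exSet (X : ℕ) (φ : MSO P Sig)

namespace MSO

variable {P Sig : Type u}

/-- Satisfaction of a formula in `M`, where `ν` interprets the event variables and `μ` the set
variables. -/
def Sat (M : MSC P Sig) (ν : ℕ → M.E) (μ : ℕ → Set M.E) : MSO P Sig → Prop
  | onProc p x => M.loc (ν x) = p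
  | hasLab a x => M.lab (ν x) = a
  | eq x y => ν x = ν y
  | proc x y => M.proc (ν x) (ν y)
  | msg x y => M.msg (ν x) (ν y)
  | le x y => M.le (ν x) (ν y)
  | mem x X => ν x ∈ μ X
  | or φ ψ => Sat M ν μ φ ∨ Sat M ν μ ψ
  | not φ => ¬ Sat M ν μ φ
  | exEvent x φ => ∃ e : M.E, Sat M (Function.update ν x e) μ φ
  | exSet X φ => ∃ A : Set M.E, Sat M ν (Function.update μ X A) φ

/-- The free event variables of a formula. -/
def freeEvent : MSO P Sig → Set ℕ
  | onProc _ x => {x}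
  | hasLab _ x => {x}
  | eq x y => {x, y}
  | proc x y => {x, y}
  | msg x y => {x, y}
  | le x y => {x, y}
  | mem x _ => {x}
  | or φ ψ => freeEvent φ ∪ freeEvent ψ
  | not φ => freeEvent φ
  | exEvent x φ => freeEvent φ \ {x}
  | exSet _ φ => freeEvent φ

/-- The free set variables of a formula. -/
def freeSet : MSO P Sig → Set ℕ
  | onProc _ _ => ∅
  | hasLab _ _ => ∅
  | eq _ _ => ∅
  | proc _ _ => ∅
  | msg _ _ => ∅
  | le _ _ => ∅
  | mem _ X => {X}
  | or φ ψ => freeSet φ ∪ freeSet ψ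
  | not φ => freeSet φ
  | exEvent _ φ => freeSet φ
  | exSet X φ => freeSet φ \ {X}

/-- A sentence is a formula without free variables. -/
def IsSentence (φ : MSO P Sig) : Prop :=
  φ.freeEvent = ∅ ∧ φ.freeSet = ∅

/-- First-order formulas: no second-order quantification (but set variables may occur). -/
def IsFO : MSO P Sig → Prop
  | onProc _ _ => True
  | hasLab _ _ => True
  | eq _ _ => True
  | proc _ _ => True
  | msg _ _ => True
  | le _ _ => True
  | mem _ _ => True
  | or φ ψ => IsFO φ ∧ IsFO ψ
  | not φ => IsFO φ
  | exEvent _ φ => IsFO φ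
  | exSet _ _ => False

/-- Existential formulas `∃ X₁ … ∃ Xₙ. φ` with `φ` first-order and `n ≥ 0`. -/
inductive IsEMSO : MSO P Sig → Prop
  | of_isFO {φ : MSO P Sig} (h : IsFO φ) : IsEMSO φ
  | exSet (X : ℕ) {φ : MSO P Sig} (h : IsEMSO φ) : IsEMSO (MSO.exSet X φ)

/-- The language of a formula, used for sentences only: there the choice of the interpretations
does not matter (and one exists, as a chart has an event). -/
def language (φ : MSO P Sig) : Set (MSC P Sig) :=
  {M | ∀ (ν : ℕ → M.E) (μ : ℕ → Set M.E), Sat M ν μ φ}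

end MSO

/-- The actions of process `p` with labels `Sig` and message contents `Msg`. -/
inductive CommAction (P Sig Msg : Type u) (p : P) : Type u where
  /-- internal action -/
  | internal (a : Sig)
  /-- write the message `m` to the channel from `p` to `q` -/
  | send (a : Sig) (m : Msg) (q : {q : P // q ≠ p})
  /-- read the message `m` from the channel from `q` to `p` -/
  | recv (a : Sig) (m : Msg) (q : {q : P // q ≠ p})

/-- The label of an action. -/
def CommAction.lab {P Sig Msg : Type u} {p : P} : CommAction P Sig Msg p → Sig
  | internal a => a
  | send a _ _ => a
  | recv a _ _ => a

/-- A communicating finite-state machine over the processes `P` and the labels `Sig`. -/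
structure CFM (P Sig : Type u) where
  /-- the message contents -/
  Msg : Type u
  finite_Msg : Finite Msg
  /-- the states of each process -/
  S : P → Type u
  finite_S : ∀ p, Finite (S p)
  /-- the initial states -/
  init : ∀ p, S p
  /-- the transition relations, as sets of triples (source, action, target) -/
  Δ : ∀ p, Set (S p × CommAction P Sig Msg p × S p)
  /-- the acceptance condition -/
  Acc : Set (∀ p, S p)

namespace CFM

variable {P Sig : Type u}

/-- A run of `A` on `M`: each event `e` on process `p` is mapped to a transition `ρ p e` of `p`. -/
structure IsRun (A : CFM P Sig) (M : MSC P Sig)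
    (ρ : ∀ p, M.Ev p → A.S p × CommAction P Sig A.Msg p × A.S p) : Prop where
  mem_Δ : ∀ p (e : M.Ev p), ρ p e ∈ A.Δ p
  lab_eq : ∀ p (e : M.Ev p), (ρ p e).2.1.lab = M.lab e.1
  source_eq_init : ∀ p (e : M.Ev p), (∀ f, ¬ M.proc f e.1) → (ρ p e).1 = A.init p
  target_eq_source : ∀ p (e f : M.Ev p), M.proc e.1 f.1 → (ρ p e).2.2 = (ρ p f).1
  internal : ∀ p (e : M.Ev p), M.IsInternal e.1 → ∃ a, (ρ p e).2.1 = CommAction.internal a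
  msg : ∀ p q (e : M.Ev p) (f : M.Ev q), M.msg e.1 f.1 →
    ∃ (a b : Sig) (m : A.Msg) (hq : q ≠ p) (hp : p ≠ q),
      (ρ p e).2.1 = CommAction.send a m ⟨q, hq⟩ ∧ (ρ q f).2.1 = CommAction.recv b m ⟨p, hp⟩

/-- The run `ρ` ends in the global state `s`: for each process `p`, `s p` is the target of the
transition at the last event of `p` (the one without outgoing process edge), and the initial
state if `p` has no event. -/
def EndsIn (A : CFM P Sig) (M : MSC P Sig)
    (ρ : ∀ p, M.Ev p → A.S p × CommAction P Sig A.Msg p × A.S p) (s : ∀ p, A.S p) : Prop :=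
  ∀ p, (IsEmpty (M.Ev p) → s p = A.init p) ∧
    ∀ e : M.Ev p, (∀ f, ¬ M.proc e.1 f) → s p = (ρ p e).2.2

/-- The language of a communicating finite-state machine: the charts with an accepting run. -/
def language (A : CFM P Sig) : Set (MSC P Sig) :=
  {M | ∃ ρ s, A.IsRun M ρ ∧ A.EndsIn M ρ s ∧ s ∈ A.Acc}

end CFM

/-- The languages defined by the sentences of existential MSO logic with process edges, message
edges and the happened-before relation. -/
def emsoLanguages (P Sig : Type u) : Set (Set (MSC P Sig)) :=
  {L | ∃ φ : MSO P Sig, φ.IsEMSO ∧ φ.IsSentence ∧ φ.language = L}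

/-- The languages of communicating finite-state machines. -/
def cfmLanguages (P Sig : Type u) : Set (Set (MSC P Sig)) :=
  {L | ∃ A : CFM P Sig, A.language = L}

-- Both formalisms are compared with labellings of the events by a finite set, subject to local
-- constraints: on single events, on first events, along process and message edges, and jointly on
-- the last events of all processes. Runs of a CFM are such labellings, and conversely a CFM can
-- guess one, with labels as states and as message contents. Set quantifiers can guess one too, and
-- the constraints are first-order. What remains is to turn a first-order formula with
-- happened-before, over charts coloured by the values of the set variables, into local constraints.
--
-- The induction on formulas keeps a normal form: disjunctions of conjunctions of binary atoms, each
-- a relation between the events of two processes that is `Tame`. This means that it is a sublattice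
-- of the product of the two chains, and that local constraints can track whether the first related
-- event in a trackable set, from either end, has a trackable property. A property of events is
-- `Trackable` if both of its truth values can be verified, so complements are available. Process
-- edges, the order of a process and, by FIFO, the channels are tame; converses and compositions
-- stay tame. Happened-before is a finite union of compositions, because a path need not return to a
-- process.
--
-- Negation (`not_rel_iff`): by the lattice property the images of `e` form an interval of the
-- range, so an unrelated `f` of the range precedes or follows all of them, and both conditions are
-- tame. Quantification over an event (`exists_update`): the atoms confine it to convex subsets of a
-- chain, which have a common element as soon as they meet pairwise, and meeting pairwise is a
-- composition of tame relations.
--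
-- For a sentence only atoms relating an event to itself remain (`trackable_loop`). The lattice
-- property reduces them to comparing `e` with its least image. Either outcome of the comparison has
-- a certificate, a set with a 2-colouring (`exists_certificate`): a false claim would force an
-- event to differ in colour from itself.

universe v w

/-! ### The linear order of the events of each process -/

section

namespace MSC

variable {P Sig : Type u} (M : MSC P Sig)

/-- A step along a process, forwards if `b` is true and backwards otherwise. -/
def step (b : Bool) (e f : M.E) : Prop := if b then M.proc e f else M.proc f e

/-- The order of the events of a process, reversed if `b` is false. -/
def ple (b : Bool) : M.E → M.E → Prop := Relation.ReflTransGen (M.step b)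

/-- The strict order of the events of a process, reversed if `b` is false. -/
def plt (b : Bool) (e f : M.E) : Prop := M.ple b e f ∧ e ≠ f

/-- The set `S` has a least event with respect to `M.ple b`, and it satisfies `X`. -/
def MinIn (b : Bool) (S X : M.E → Prop) : Prop :=
  ∃ f, (S f ∧ ∀ g, S g → M.ple b f g) ∧ X f

variable {M}

theorem step_not {b : Bool} {e f : M.E} : M.step (!b) e f ↔ M.step b f e := by
  cases b <;> simp [step]

theorem step_loc {b : Bool} {e f : M.E} (h : M.step b e f) : M.loc e = M.loc f := by
  cases b
  · exact (M.loc_eq_of_proc _ _ (by simpa [step] using h)).symm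
  · exact M.loc_eq_of_proc _ _ (by simpa [step] using h)

theorem proc_unique_right {e f g : M.E} (hf : M.proc e f) (hg : M.proc e g) : f = g := by
  obtain ⟨_, h⟩ := M.proc_succ (M.loc e)
  have h1 := (h ⟨e, rfl⟩ ⟨f, (M.loc_eq_of_proc _ _ hf).symm⟩).1 hf
  have h2 := (h ⟨e, rfl⟩ ⟨g, (M.loc_eq_of_proc _ _ hg).symm⟩).1 hg
  exact congrArg Subtype.val (h1.unique_right h2)

theorem proc_unique_left {e f g : M.E} (hf : M.proc f e) (hg : M.proc g e) : f = g := by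
  obtain ⟨_, h⟩ := M.proc_succ (M.loc e)
  have h1 := (h ⟨f, M.loc_eq_of_proc _ _ hf⟩ ⟨e, rfl⟩).1 hf
  have h2 := (h ⟨g, M.loc_eq_of_proc _ _ hg⟩ ⟨e, rfl⟩).1 hg
  exact congrArg Subtype.val (h1.unique_left h2)

theorem step_unique {b : Bool} {e f g : M.E} (hf : M.step b e f) (hg : M.step b e g) : f = g := by
  cases b
  · exact proc_unique_left (by simpa [step] using hf) (by simpa [step] using hg)
  · exact proc_unique_right (by simpa [step] using hf) (by simpa [step] using hg)

theorem ple_refl {b : Bool} (e : M.E) : M.ple b e e := Relation.ReflTransGen.refl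

theorem ple_trans {b : Bool} {e f g : M.E} (h : M.ple b e f) (h' : M.ple b f g) : M.ple b e g :=
  Relation.ReflTransGen.trans h h'

theorem ple_not {b : Bool} {e f : M.E} : M.ple (!b) e f ↔ M.ple b f e := by
  have : M.step (!b) = Function.swap (M.step b) := by
    funext x y; exact propext step_not
  rw [ple, this, Relation.reflTransGen_swap, ple]

theorem ple_loc {b : Bool} {e f : M.E} (h : M.ple b e f) : M.loc e = M.loc f := by
  induction h with
  | refl => rfl
  | tail _ h ih => exact ih.trans (step_loc h)

theorem le_of_ple {e f : M.E} (h : M.ple true e f) : M.le e f :=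
  Relation.ReflTransGen.mono (fun a b hab => Or.inl (by simpa [step] using hab)) _ _ h

theorem le_antisymm {e f : M.E} (h : M.le e f) (h' : M.le f e) : e = f := by
  by_contra hne
  rcases Relation.reflTransGen_iff_eq_or_transGen.1 h with h0 | h0
  · exact hne h0.symm
  · exact M.acyclic e (h0.trans_left h')

theorem ple_antisymm {b : Bool} {e f : M.E} (h : M.ple b e f) (h' : M.ple b f e) : e = f := by
  cases b
  · exact le_antisymm (le_of_ple (ple_not (b := true).1 h')) (le_of_ple (ple_not (b := true).1 h))
  · exact le_antisymm (le_of_ple h) (le_of_ple h')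

/-- A finite linear order is generated by its direct-successor relation. -/
theorem ple_total {b : Bool} {e f : M.E} (h : M.loc e = M.loc f) : M.ple b e f ∨ M.ple b f e := by
  suffices H : M.ple true e f ∨ M.ple true f e by
    cases b
    · exact H.elim (fun h => Or.inr (ple_not (b := true).2 h))
        (fun h => Or.inl (ple_not (b := true).2 h))
    · exact H
  obtain ⟨_, hs⟩ := M.proc_succ (M.loc f)
  have := M.finite_E
  have := Fintype.ofFinite {x : M.E // M.loc x = M.loc f}
  let _ := Fintype.toLocallyFiniteOrder (α := {x : M.E // M.loc x = M.loc f})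
  have key : ∀ x y : {x : M.E // M.loc x = M.loc f}, x ≤ y → M.ple true x.1 y.1 := by
    intro x y hxy
    have := le_iff_reflTransGen_covBy.1 hxy
    exact Relation.ReflTransGen.lift Subtype.val
      (fun a b hab => by simpa [step] using (hs a b).2 hab) _ _ this
  exact (le_total (⟨e, h⟩ : {x : M.E // M.loc x = M.loc f}) ⟨f, rfl⟩).imp (key _ _) (key _ _)

theorem plt_irrefl {b : Bool} (e : M.E) : ¬ M.plt b e e := fun h => h.2 rfl

theorem plt_of_ple_of_plt {b : Bool} {e f g : M.E} (h : M.ple b e f) (h' : M.plt b f g) :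
    M.plt b e g := by
  refine ⟨ple_trans h h'.1, ?_⟩
  rintro rfl
  exact h'.2 (ple_antisymm h'.1 h)

theorem plt_of_plt_of_ple {b : Bool} {e f g : M.E} (h : M.plt b e f) (h' : M.ple b f g) :
    M.plt b e g := by
  refine ⟨ple_trans h.1 h', ?_⟩
  rintro rfl
  exact h.2 (ple_antisymm h.1 h')

theorem plt_not {b : Bool} {e f : M.E} : M.plt (!b) e f ↔ M.plt b f e := by
  simp [plt, ple_not, ne_comm]

theorem not_plt_of_ple {b : Bool} {e f : M.E} (h : M.ple b e f) : ¬ M.plt b f e :=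
  fun h' => plt_irrefl _ (plt_of_ple_of_plt h h')

theorem ple_of_not_plt {b : Bool} {e f : M.E} (hl : M.loc e = M.loc f) (h : ¬ M.plt b f e) :
    M.ple b e f := by
  rcases ple_total (b := b) hl with h' | h'
  · exact h'
  · by_cases hef : f = e
    · exact hef ▸ ple_refl _
    · exact absurd ⟨h', hef⟩ h

theorem plt_of_step {b : Bool} {e f : M.E} (h : M.step b e f) : M.plt b e f := by
  refine ⟨Relation.ReflTransGen.single h, ?_⟩
  rintro rfl
  refine M.acyclic e (Relation.TransGen.single (Or.inl ?_))
  cases b <;> simpa [step] using h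

theorem plt_iff_step {b : Bool} {e f : M.E} :
    M.plt b e f ↔ ∃ g, M.step b e g ∧ M.ple b g f := by
  constructor
  · rintro ⟨h, hne⟩
    rcases Relation.ReflTransGen.cases_head h with h | ⟨g, hg, h⟩
    · exact absurd h hne
    · exact ⟨g, hg, h⟩
  · rintro ⟨g, hg, h⟩
    exact plt_of_plt_of_ple (plt_of_step hg) h

theorem wellFounded_plt (M : MSC P Sig) (b : Bool) : WellFounded (M.plt b) := by
  have := M.finite_E
  have : Std.Irrefl (M.plt b) := ⟨plt_irrefl⟩
  have : IsTrans M.E (M.plt b) := ⟨fun _ _ _ h h' => plt_of_plt_of_ple h h'.1⟩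
  exact Finite.wellFounded_of_trans_of_irrefl _

theorem exists_min (b : Bool) {S : M.E → Prop} {q : P} (hq : ∀ f, S f → M.loc f = q)
    (hS : ∃ f, S f) : ∃ f, S f ∧ ∀ g, S g → M.ple b f g := by
  obtain ⟨f, hf, hmin⟩ := (wellFounded_plt M b).has_min {f | S f} hS
  exact ⟨f, hf, fun g hg => ple_of_not_plt ((hq f hf).trans (hq g hg).symm) (hmin g hg)⟩

theorem minIn_true {b : Bool} {S X : M.E → Prop} {q : P} (hq : ∀ f, S f → M.loc f = q)
    (hX : ∀ f, X f) : M.MinIn b S X ↔ ∃ f, S f := by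
  constructor
  · rintro ⟨f, ⟨hf, -⟩, -⟩
    exact ⟨f, hf⟩
  · intro h
    obtain ⟨f, hf⟩ := exists_min b hq h
    exact ⟨f, hf, hX f⟩

theorem minIn_of_unique {b : Bool} {S X : M.E → Prop} (h : ∀ f g, S f → S g → f = g) :
    M.MinIn b S X ↔ ∃ f, S f ∧ X f := by
  constructor
  · rintro ⟨f, ⟨hf, -⟩, hX⟩
    exact ⟨f, hf, hX⟩
  · rintro ⟨f, hf, hX⟩
    exact ⟨f, ⟨hf, fun g hg => h f g hf hg ▸ ple_refl _⟩, hX⟩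

open Classical in
/-- The value of `d` at the last event of each process, and `none` for a process without events. -/
noncomputable def last {D : Type v} (M : MSC P Sig) (d : M.E → D) (p : P) : Option D :=
  if h : ∃ e, M.loc e = p ∧ ∀ f, ¬ M.proc e f then some (d h.choose) else none

theorem last_unique {e f : M.E} (he : ∀ g, ¬ M.proc e g) (hf : ∀ g, ¬ M.proc f g)
    (h : M.loc e = M.loc f) : e = f := by
  have key : ∀ x y : M.E, (∀ g, ¬ M.proc x g) → M.ple true x y → x = y := by
    intro x y hx hxy
    by_contra hne
    obtain ⟨g, hg, -⟩ := plt_iff_step.1 ⟨hxy, hne⟩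
    exact hx g (by simpa [step] using hg)
  rcases ple_total (b := true) h with h | h
  · exact key _ _ he h
  · exact (key _ _ hf h).symm

theorem exists_last (e : M.E) : ∃ f, M.ple true e f ∧ ∀ g, ¬ M.proc f g := by
  obtain ⟨f, hf, hmin⟩ := exists_min (M := M) false (S := fun f => M.loc f = M.loc e)
    (q := M.loc e) (fun f hf => hf) ⟨e, rfl⟩
  refine ⟨f, ple_not (b := true).1 (hmin e rfl), fun g hg => ?_⟩
  have hg' : M.plt true f g := plt_of_step (by simpa [step] using hg)
  exact not_plt_of_ple (ple_not (b := true).1 (hmin g ((M.loc_eq_of_proc _ _ hg).symm.trans hf)))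
    hg'

theorem last_eq_some_iff {D : Type v} {d : M.E → D} {p : P} {x : D} :
    M.last d p = some x ↔ ∃ e, M.loc e = p ∧ (∀ f, ¬ M.proc e f) ∧ d e = x := by
  unfold last
  split_ifs with h
  · simp only [Option.some.injEq]
    constructor
    · rintro rfl
      exact ⟨_, h.choose_spec.1, h.choose_spec.2, rfl⟩
    · rintro ⟨e, he, hl, rfl⟩
      rw [last_unique h.choose_spec.2 hl (h.choose_spec.1.trans he.symm)]
  · simp only [false_iff]
    rintro ⟨e, he, hl, -⟩
    exact h ⟨e, he, hl⟩

theorem last_eq_none_iff {D : Type v} {d : M.E → D} {p : P} :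
    M.last d p = none ↔ ∀ e, M.loc e ≠ p := by
  constructor
  · intro h e he
    obtain ⟨f, hf, hl⟩ := exists_last e
    have := (last_eq_some_iff (d := d)).2 ⟨f, (ple_loc hf).symm.trans he, hl, rfl⟩
    rw [h] at this
    cases this
  · intro h
    by_contra hne
    obtain ⟨x, hx⟩ := Option.ne_none_iff_exists'.1 hne
    obtain ⟨e, he, -⟩ := last_eq_some_iff.1 hx
    exact h e he

theorem last_comp {D : Type v} {D' : Type w} (h : D → D') (d : M.E → D) (p : P) :
    M.last (fun e => h (d e)) p = (M.last d p).map h := by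
  unfold last
  split_ifs <;> rfl

end MSC

/-! ### Local constraints and recognizable properties -/

/-- A system of local constraints on labellings of charts with colours in `C` by elements of the
finite type `D`. -/
structure LocalSystem (P Sig : Type u) (C : Type w) where
  /-- the labels -/
  D : Type v
  finite_D : Finite D
  /-- constraint on single events -/
  node : P → Sig → C → D → Prop
  /-- constraint on events without message -/
  internal : D → Prop
  /-- constraint on the first event of a process -/
  first : D → Prop
  /-- constraint on process edges -/
  proc : D → D → Prop
  /-- constraint on message edges -/
  msg : D → D → Prop
  /-- constraint on the last events of all processes -/
  acc : (P → Option D) → Prop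

variable {P Sig : Type u} {C : Type w}

/-- The labelling `d` of the coloured chart satisfies all constraints. -/
structure LocalSystem.Valid (s : LocalSystem.{u, v, w} P Sig C) (M : MSC P Sig) (c : M.E → C)
    (d : M.E → s.D) : Prop where
  node : ∀ e, s.node (M.loc e) (M.lab e) (c e) (d e)
  internal : ∀ e, M.IsInternal e → s.internal (d e)
  first : ∀ e, (∀ f, ¬ M.proc f e) → s.first (d e)
  proc : ∀ e f, M.proc e f → s.proc (d e) (d f)
  msg : ∀ e f, M.msg e f → s.msg (d e) (d f)
  acc : s.acc (M.last d)

/-- The system without constraints. -/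
def LocalSystem.free (P Sig : Type u) (C : Type w) (D : Type v) [Finite D] :
    LocalSystem.{u, v, w} P Sig C where
  D := D
  finite_D := inferInstance
  node _ _ _ _ := True
  internal _ := True
  first _ := True
  proc _ _ := True
  msg _ _ := True
  acc _ := True

/-- A property of coloured charts is recognizable if it says that a system of local constraints
can be satisfied. -/
def Recognizable (K : ∀ M : MSC P Sig, (M.E → C) → Prop) : Prop :=
  ∃ s : LocalSystem.{u, 0, w} P Sig C, ∀ M c, K M c ↔ ∃ d, s.Valid M c d

namespace Recognizable

variable {C' : Type v} {B : Type}

theorem congr {K L : ∀ M : MSC P Sig, (M.E → C) → Prop} (h : Recognizable K)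
    (hKL : ∀ M c, L M c ↔ K M c) : Recognizable L := by
  obtain ⟨s, hs⟩ := h
  exact ⟨s, fun M c => (hKL M c).trans (hs M c)⟩

theorem and {K L : ∀ M : MSC P Sig, (M.E → C) → Prop} (hK : Recognizable K)
    (hL : Recognizable L) : Recognizable (fun M c => K M c ∧ L M c) := by
  obtain ⟨s, hs⟩ := hK
  obtain ⟨t, ht⟩ := hL
  have := s.finite_D
  have := t.finite_D
  refine ⟨⟨s.D × t.D, inferInstance, fun p a c d => s.node p a c d.1 ∧ t.node p a c d.2,
    fun d => s.internal d.1 ∧ t.internal d.2, fun d => s.first d.1 ∧ t.first d.2,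
    fun d d' => s.proc d.1 d'.1 ∧ t.proc d.2 d'.2, fun d d' => s.msg d.1 d'.1 ∧ t.msg d.2 d'.2,
    fun σ => s.acc (fun p => (σ p).map Prod.fst) ∧ t.acc (fun p => (σ p).map Prod.snd)⟩,
    fun M c => ?_⟩
  simp only [hs, ht]
  constructor
  · rintro ⟨⟨d, hd⟩, ⟨d', hd'⟩⟩
    refine ⟨fun e => (d e, d' e), ⟨fun e => ⟨hd.node e, hd'.node e⟩,
      fun e h => ⟨hd.internal e h, hd'.internal e h⟩, fun e h => ⟨hd.first e h, hd'.first e h⟩,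
      fun e f h => ⟨hd.proc e f h, hd'.proc e f h⟩, fun e f h => ⟨hd.msg e f h, hd'.msg e f h⟩, ?_⟩⟩
    simp only [← MSC.last_comp]
    exact ⟨hd.acc, hd'.acc⟩
  · rintro ⟨d, hd⟩
    have hacc := hd.acc
    simp only [← MSC.last_comp] at hacc
    exact ⟨⟨fun e => (d e).1, ⟨fun e => (hd.node e).1, fun e h => (hd.internal e h).1,
      fun e h => (hd.first e h).1, fun e f h => (hd.proc e f h).1, fun e f h => (hd.msg e f h).1,
      hacc.1⟩⟩, ⟨fun e => (d e).2, ⟨fun e => (hd.node e).2, fun e h => (hd.internal e h).2,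
      fun e h => (hd.first e h).2, fun e f h => (hd.proc e f h).2, fun e f h => (hd.msg e f h).2,
      hacc.2⟩⟩⟩

theorem comap {K : ∀ M : MSC P Sig, (M.E → C) → Prop} (hK : Recognizable K) (h : C' → C) :
    Recognizable (fun M (c : M.E → C') => K M (fun e => h (c e))) := by
  obtain ⟨s, hs⟩ := hK
  exact ⟨⟨s.D, s.finite_D, fun p a c d => s.node p a (h c) d, s.internal, s.first, s.proc, s.msg,
    s.acc⟩, fun M c => (hs M _).trans ⟨fun ⟨d, hd⟩ => ⟨d, ⟨hd.1, hd.2, hd.3, hd.4, hd.5, hd.6⟩⟩,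
      fun ⟨d, hd⟩ => ⟨d, ⟨hd.1, hd.2, hd.3, hd.4, hd.5, hd.6⟩⟩⟩⟩

/-- The quantified colours become part of the labels, which is why `B` has to be finite while `C`
need not be. -/
theorem proj [Finite B] {K : ∀ M : MSC P Sig, (M.E → C × B) → Prop} (hK : Recognizable K) :
    Recognizable (fun M c => ∃ b : M.E → B, K M (fun e => (c e, b e))) := by
  obtain ⟨s, hs⟩ := hK
  have := s.finite_D
  refine ⟨⟨B × s.D, inferInstance, fun p a c d => s.node p a (c, d.1) d.2,
    fun d => s.internal d.2, fun d => s.first d.2, fun d d' => s.proc d.2 d'.2,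
    fun d d' => s.msg d.2 d'.2, fun σ => s.acc (fun p => (σ p).map Prod.snd)⟩, fun M c => ?_⟩
  simp only [hs]
  constructor
  · rintro ⟨b, d, hd⟩
    refine ⟨fun e => (b e, d e), ⟨hd.node, hd.internal, hd.first, hd.proc, hd.msg, ?_⟩⟩
    simp only [← MSC.last_comp]
    exact hd.acc
  · rintro ⟨d, hd⟩
    have hacc := hd.acc
    simp only [← MSC.last_comp] at hacc
    exact ⟨fun e => (d e).1, fun e => (d e).2,
      ⟨hd.node, hd.internal, hd.first, hd.proc, hd.msg, hacc⟩⟩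

/-- A system of local constraints on the colours themselves. -/
theorem valid (s : LocalSystem.{u, 0, 0} P Sig PUnit) :
    Recognizable (fun M (c : M.E → s.D) => s.Valid M (fun _ => PUnit.unit) c) := by
  refine ⟨⟨s.D, s.finite_D, fun p a c d => s.node p a .unit d ∧ d = c, s.internal, s.first, s.proc,
    s.msg, s.acc⟩, fun M c =>
      ⟨fun hc => ⟨c, ⟨fun e => ⟨hc.1 e, rfl⟩, hc.2, hc.3, hc.4, hc.5, hc.6⟩⟩,
      ?_⟩⟩
  rintro ⟨d, hd⟩
  obtain rfl : d = c := funext fun e => (hd.node e).2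
  exact ⟨fun e => (hd.node e).1, hd.2, hd.3, hd.4, hd.5, hd.6⟩

theorem node (φ : P → Sig → C → Prop) :
    Recognizable (fun M (c : M.E → C) => ∀ e, φ (M.loc e) (M.lab e) (c e)) :=
  ⟨{ LocalSystem.free P Sig C PUnit with node := fun p a c _ => φ p a c },
    fun _ _ => ⟨fun h => ⟨fun _ => .unit, ⟨h, fun _ _ => trivial, fun _ _ => trivial,
      fun _ _ _ => trivial, fun _ _ _ => trivial, trivial⟩⟩, fun ⟨_, hd⟩ => hd.node⟩⟩

variable [Finite B] (h : C → B)

theorem internal (φ : B → Prop) :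
    Recognizable (fun M : MSC P Sig => fun c => ∀ e, M.IsInternal e → φ (h (c e))) :=
  ((valid { LocalSystem.free P Sig PUnit B with internal := φ }).comap h).congr fun _ _ =>
    ⟨fun h => ⟨fun _ => trivial, h, fun _ _ => trivial, fun _ _ _ => trivial, fun _ _ _ => trivial,
      trivial⟩, fun h => h.internal⟩

theorem first (φ : B → Prop) :
    Recognizable (fun M : MSC P Sig => fun c => ∀ e, (∀ f, ¬ M.proc f e) → φ (h (c e))) :=
  ((valid { LocalSystem.free P Sig PUnit B with first := φ }).comap h).congr fun _ _ =>
    ⟨fun h => ⟨fun _ => trivial, fun _ _ => trivial, h, fun _ _ _ => trivial, fun _ _ _ => trivial,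
      trivial⟩, fun h => h.first⟩

theorem proc (φ : B → B → Prop) :
    Recognizable (fun M : MSC P Sig => fun c => ∀ e f, M.proc e f → φ (h (c e)) (h (c f))) :=
  ((valid { LocalSystem.free P Sig PUnit B with proc := φ }).comap h).congr fun _ _ =>
    ⟨fun h => ⟨fun _ => trivial, fun _ _ => trivial, fun _ _ => trivial, h, fun _ _ _ => trivial,
      trivial⟩, fun h => h.proc⟩

theorem msg (φ : B → B → Prop) :
    Recognizable (fun M : MSC P Sig => fun c => ∀ e f, M.msg e f → φ (h (c e)) (h (c f))) :=
  ((valid { LocalSystem.free P Sig PUnit B with msg := φ }).comap h).congr fun _ _ =>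
    ⟨fun h => ⟨fun _ => trivial, fun _ _ => trivial, fun _ _ => trivial, fun _ _ _ => trivial, h,
      trivial⟩, fun h => h.msg⟩

theorem acc (φ : (P → Option B) → Prop) :
    Recognizable (fun M : MSC P Sig => fun c => φ (M.last (fun e => h (c e)))) :=
  ((valid { LocalSystem.free P Sig PUnit B with acc := φ }).comap h).congr fun _ _ =>
    ⟨fun h => ⟨fun _ => trivial, fun _ _ => trivial, fun _ _ => trivial, fun _ _ _ => trivial,
      fun _ _ _ => trivial, h⟩, fun h => h.acc⟩

end Recognizable

end

/-! ### Trackable properties of events -/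

section

/-- Properties of the events of coloured charts. -/
abbrev EventPred (P Sig : Type u) (C : Type) := ∀ M : MSC P Sig, (M.E → C) → M.E → Prop

/-- A property of events is trackable if local constraints can determine where it holds. -/
def Trackable {P Sig : Type u} {C : Type} (U : EventPred P Sig C) : Prop :=
  Recognizable (fun M (c : M.E → C × Prop) => ∀ e, (c e).2 ↔ U M (fun e => (c e).1) e)

variable {P Sig : Type u} {C C' : Type}

/-- The values of `U` are guessed as an extra colour. Trackability fixes both truth values, so the
guess is unique and can be used as if it were given. -/
theorem Recognizable.subst {U : EventPred P Sig C} (hU : Trackable U)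
    {K : ∀ M : MSC P Sig, (M.E → C × Prop) → Prop} (hK : Recognizable K) :
    Recognizable (fun M c => K M (fun e => (c e, U M c e))) := by
  refine (Recognizable.proj (B := Prop) (hU.and hK)).congr fun M c => ⟨fun h => ?_, ?_⟩
  · exact ⟨U M c, fun _ => Iff.rfl, h⟩
  · rintro ⟨b, hb, h⟩
    obtain rfl : b = U M c := funext fun e => propext (hb e)
    exact h

namespace Trackable

theorem comap {U : EventPred P Sig C} (hU : Trackable U) (h : C' → C) :
    Trackable (fun M (c : M.E → C') => U M (fun e => h (c e))) :=
  Recognizable.comap hU (C' := C' × Prop) fun x => (h x.1, x.2)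

theorem congr {U V : EventPred P Sig C} (hU : Trackable U) (h : ∀ M c e, V M c e ↔ U M c e) :
    Trackable V := by
  obtain rfl : V = U := by
    funext M c e
    exact propext (h M c e)
  exact hU

/-- No monotonicity is asked of `g`, so complements are covered. -/
theorem comb₂ {U V : EventPred P Sig C} (hU : Trackable U) (hV : Trackable V)
    (g : P → Sig → C → Prop → Prop → Prop) :
    Trackable (fun M c e => g (M.loc e) (M.lab e) (c e) (U M c e) (V M c e)) :=
  Recognizable.subst (hU.comap Prod.fst)
    (Recognizable.subst (hV.comap fun x : (C × Prop) × Prop => x.1.1)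
    (Recognizable.node fun p a (x : ((C × Prop) × Prop) × Prop) =>
      x.1.1.2 ↔ g p a x.1.1.1 x.1.2 x.2))

theorem node (g : P → Sig → C → Prop) :
    Trackable (fun M c e => g (M.loc e) (M.lab e) (c e) : EventPred P Sig C) :=
  Recognizable.node fun p a (x : C × Prop) => x.2 ↔ g p a x.1

theorem and {U V : EventPred P Sig C} (hU : Trackable U) (hV : Trackable V) :
    Trackable (fun M c e => U M c e ∧ V M c e) := comb₂ hU hV fun _ _ _ x y => x ∧ y

theorem or {U V : EventPred P Sig C} (hU : Trackable U) (hV : Trackable V) :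
    Trackable (fun M c e => U M c e ∨ V M c e) := comb₂ hU hV fun _ _ _ x y => x ∨ y

theorem imp {U V : EventPred P Sig C} (hU : Trackable U) (hV : Trackable V) :
    Trackable (fun M c e => U M c e → V M c e) := comb₂ hU hV fun _ _ _ x y => x → y

theorem not {U : EventPred P Sig C} (hU : Trackable U) :
    Trackable (fun M c e => ¬ U M c e) := comb₂ hU hU fun _ _ _ x _ => ¬ x

theorem const (q : Prop) : Trackable (fun _ _ _ => q : EventPred P Sig C) :=
  node fun _ _ _ => q

theorem loc (p : P) : Trackable (fun M _ e => M.loc e = p : EventPred P Sig C) :=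
  node fun q _ _ => q = p

theorem color (g : C → Prop) : Trackable (fun _ c e => g (c e) : EventPred P Sig C) :=
  node fun _ _ x => g x

theorem forall_recognizable {U : EventPred P Sig C} (hU : Trackable U) :
    Recognizable (fun M c => ∀ e, U M c e) :=
  Recognizable.subst hU (Recognizable.node fun _ _ (x : C × Prop) => x.2)

/-- A property of events is trackable if a guessed labelling that determines it can be verified. -/
theorem of_guess {U : EventPred P Sig C} {B : Type} [Finite B] (out : B → Prop)
    {K : ∀ M : MSC P Sig, (M.E → C × B) → Prop} (hK : Recognizable K)
    (hex : ∀ (M : MSC P Sig) (c : M.E → C), ∃ b : M.E → B, K M (fun e => (c e, b e)))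
    (hout : ∀ (M : MSC P Sig) (c : M.E → C) (b : M.E → B), K M (fun e => (c e, b e)) →
      ∀ e, out (b e) ↔ U M c e) : Trackable U := by
  refine (Recognizable.proj (B := B) ((hK.comap fun x : (C × Prop) × B => (x.1.1, x.2)).and
    (Recognizable.node fun _ _ (x : (C × Prop) × B) => x.1.2 ↔ out x.2))).congr
    fun M c => ⟨fun h => ?_, ?_⟩
  · obtain ⟨b, hb⟩ := hex M fun e => (c e).1
    exact ⟨b, hb, fun e => (h e).trans (hout _ _ _ hb e).symm⟩
  · rintro ⟨b, hb, h⟩ e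
    exact (h e).trans (hout _ _ _ hb e)

theorem step (b : Bool) {U : EventPred P Sig C} (hU : Trackable U) :
    Trackable (fun M c e => ∃ f, M.step b e f ∧ U M c f) := by
  suffices H : Trackable (fun M (c : M.E → C × Prop) e => ∃ f, M.step b e f ∧ (c f).2) from
    Recognizable.subst (hU.comap Prod.fst) (K := fun M c => ∀ e, (c e).1.2 ↔
      ∃ f, M.step b e f ∧ (c f).2)
      (Recognizable.comap H (C' := (C × Prop) × Prop) fun x => ((x.1.1, x.2), x.1.2))
  cases b
  -- Looking back: the guess is false at first events and passed on along process edges.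
  · refine ((Recognizable.first (fun x : (C × Prop) × Prop => x.2) fun y => ¬ y).and
      (Recognizable.proc (fun x : (C × Prop) × Prop => (x.1.2, x.2)) fun x y => y.2 ↔ x.1)).congr
      fun M c => ⟨fun h => ⟨fun e he hy => ?_, fun e f hef => ?_⟩, fun ⟨h, h'⟩ e => ?_⟩
    · obtain ⟨f, hf, -⟩ := (h e).1 hy
      exact he f (by simpa [MSC.step] using hf)
    · refine (h f).trans ⟨?_, fun hx => ⟨e, by simpa [MSC.step] using hef, hx⟩⟩
      rintro ⟨g, hg, hx⟩
      rwa [MSC.proc_unique_left hef (by simpa [MSC.step] using hg)]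
    · by_cases hp : ∃ f, M.proc f e
      · obtain ⟨f, hf⟩ := hp
        refine (h' f e hf).trans ⟨fun hx => ⟨f, by simpa [MSC.step] using hf, hx⟩, ?_⟩
        rintro ⟨g, hg, hx⟩
        exact (MSC.proc_unique_left hf (by simpa [MSC.step] using hg)) ▸ hx
      · have hp' := not_exists.1 hp
        exact ⟨fun hy => absurd hy (h e hp'),
          fun ⟨f, hf, _⟩ => absurd (by simpa [MSC.step] using hf) (hp' f)⟩
  -- Looking ahead: the guess is a prediction about the next event, and at last events the
  -- acceptance condition forces it to be false.
  · refine ((Recognizable.acc (fun x : (C × Prop) × Prop => x.2)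
      fun σ => ∀ p y, σ p = some y → ¬ y).and
      (Recognizable.proc (fun x : (C × Prop) × Prop => (x.1.2, x.2)) fun x y => x.2 ↔ y.1)).congr
      fun M c => ⟨fun h => ⟨fun p y he hy => ?_, fun e f hef => ?_⟩, fun ⟨h, h'⟩ e => ?_⟩
    · obtain ⟨e, -, hl, rfl⟩ := MSC.last_eq_some_iff.1 he
      obtain ⟨f, hf, -⟩ := (h e).1 hy
      exact hl f (by simpa [MSC.step] using hf)
    · refine (h e).trans ⟨?_, fun hx => ⟨f, by simpa [MSC.step] using hef, hx⟩⟩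
      rintro ⟨g, hg, hx⟩
      rwa [MSC.proc_unique_right hef (by simpa [MSC.step] using hg)]
    · by_cases hp : ∃ f, M.proc e f
      · obtain ⟨f, hf⟩ := hp
        refine (h' e f hf).trans ⟨fun hx => ⟨f, by simpa [MSC.step] using hf, hx⟩, ?_⟩
        rintro ⟨g, hg, hx⟩
        exact (MSC.proc_unique_right hf (by simpa [MSC.step] using hg)) ▸ hx
      · have hp' := not_exists.1 hp
        exact ⟨fun hy => absurd hy (h _ _ (MSC.last_eq_some_iff.2 ⟨e, rfl, hp', rfl⟩)),
          fun ⟨f, hf, _⟩ => absurd (by simpa [MSC.step] using hf) (hp' f)⟩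

theorem msg {U : EventPred P Sig C} (hU : Trackable U) :
    Trackable (fun M c e => ∃ f, M.msg e f ∧ U M c f) := by
  suffices H : Trackable (fun M (c : M.E → C × Prop) e => ∃ f, M.msg e f ∧ (c f).2) from
    Recognizable.subst (hU.comap Prod.fst) (K := fun M c => ∀ e, (c e).1.2 ↔
      ∃ f, M.msg e f ∧ (c f).2)
      (Recognizable.comap H (C' := (C × Prop) × Prop) fun x => ((x.1.1, x.2), x.1.2))
  -- False at internal events and at receive events; at a send event it must agree with the value at
  -- the receive event.
  refine ((Recognizable.internal (fun x : (C × Prop) × Prop => x.2) fun y => ¬ y).and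
    (Recognizable.msg (fun x : (C × Prop) × Prop => (x.1.2, x.2))
      fun x y => (x.2 ↔ y.1) ∧ ¬ y.2)).congr
    fun M c => ⟨fun h => ⟨fun e he hy => ?_, fun e f hef => ⟨?_, fun hy => ?_⟩⟩,
      fun ⟨h, h'⟩ e => ⟨fun hy => ?_, ?_⟩⟩
  · obtain ⟨f, hf, -⟩ := (h e).1 hy
    exact (he f).1 hf
  · refine (h e).trans ⟨?_, fun hx => ⟨f, hef, hx⟩⟩
    rintro ⟨g, hg, hx⟩
    rwa [(M.msg_unique _ _ _ _ hef hg (Or.inl rfl)).2]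
  · obtain ⟨g, hg, -⟩ := (h f).1 hy
    obtain ⟨rfl, -⟩ := M.msg_unique _ _ _ _ hef hg (Or.inr (Or.inr (Or.inl rfl)))
    exact M.loc_ne_of_msg _ _ hef rfl
  · by_cases hi : M.IsInternal e
    · exact absurd hy (h e hi)
    · simp only [MSC.IsInternal, not_forall, not_and_or, not_not] at hi
      obtain ⟨f, hf | hf⟩ := hi
      · exact ⟨f, hf, (h' e f hf).1.1 hy⟩
      · exact absurd hy (h' f e hf).2
  · rintro ⟨f, hf, hx⟩
    exact (h' e f hf).1.2 hx

theorem msg_swap {U : EventPred P Sig C} (hU : Trackable U) :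
    Trackable (fun M c e => ∃ f, M.msg f e ∧ U M c f) := by
  suffices H : Trackable (fun M (c : M.E → C × Prop) e => ∃ f, M.msg f e ∧ (c f).2) from
    Recognizable.subst (hU.comap Prod.fst) (K := fun M c => ∀ e, (c e).1.2 ↔
      ∃ f, M.msg f e ∧ (c f).2)
      (Recognizable.comap H (C' := (C × Prop) × Prop) fun x => ((x.1.1, x.2), x.1.2))
  refine ((Recognizable.internal (fun x : (C × Prop) × Prop => x.2) fun y => ¬ y).and
    (Recognizable.msg (fun x : (C × Prop) × Prop => (x.1.2, x.2))
      fun x y => (y.2 ↔ x.1) ∧ ¬ x.2)).congr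
    fun M c => ⟨fun h => ⟨fun e he hy => ?_, fun e f hef => ⟨?_, fun hy => ?_⟩⟩,
      fun ⟨h, h'⟩ e => ⟨fun hy => ?_, ?_⟩⟩
  · obtain ⟨f, hf, -⟩ := (h e).1 hy
    exact (he f).2 hf
  · refine (h f).trans ⟨?_, fun hx => ⟨e, hef, hx⟩⟩
    rintro ⟨g, hg, hx⟩
    rwa [(M.msg_unique _ _ _ _ hef hg (Or.inr (Or.inr (Or.inr rfl)))).1]
  · obtain ⟨g, hg, -⟩ := (h e).1 hy
    obtain ⟨rfl, -⟩ := M.msg_unique _ _ _ _ hg hef (Or.inr (Or.inr (Or.inl rfl)))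
    exact M.loc_ne_of_msg _ _ hg rfl
  · by_cases hi : M.IsInternal e
    · exact absurd hy (h e hi)
    · simp only [MSC.IsInternal, not_forall, not_and_or, not_not] at hi
      obtain ⟨f, hf | hf⟩ := hi
      · exact absurd hy (h' e f hf).2
      · exact ⟨f, hf, (h' f e hf).1.1 hy⟩
  · rintro ⟨f, hf, hx⟩
    exact (h' f e hf).1.2 hx

end Trackable

/-- The next event either is the first one in `U` or can be skipped. -/
theorem MSC.minIn_plt_iff {M : MSC P Sig} {b : Bool} {U X : M.E → Prop} {e : M.E} :
    M.MinIn b (fun f => M.plt b e f ∧ U f) X ↔ ∃ f, M.step b e f ∧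
      ((U f ∧ X f) ∨ (¬ U f ∧ M.MinIn b (fun g => M.plt b f g ∧ U g) X)) := by
  constructor
  · rintro ⟨f, ⟨⟨hf, hU⟩, hmin⟩, hX⟩
    obtain ⟨g, hg, hgf⟩ := plt_iff_step.1 hf
    refine ⟨g, hg, ?_⟩
    by_cases hgU : U g
    · have := hmin g ⟨plt_of_step hg, hgU⟩
      obtain rfl := ple_antisymm this hgf
      exact Or.inl ⟨hU, hX⟩
    · refine Or.inr ⟨hgU, f, ⟨⟨⟨hgf, ?_⟩, hU⟩, fun x hx =>
        hmin x ⟨plt_of_plt_of_ple (plt_of_step hg) hx.1.1, hx.2⟩⟩, hX⟩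
      rintro rfl
      exact hgU hU
  · rintro ⟨g, hg, ⟨hU, hX⟩ | ⟨hU, f, ⟨⟨hf, hfU⟩, hmin⟩, hX⟩⟩
    · refine ⟨g, ⟨⟨plt_of_step hg, hU⟩, fun x hx => ?_⟩, hX⟩
      obtain ⟨g', hg', h⟩ := plt_iff_step.1 hx.1
      rwa [step_unique hg hg']
    · refine ⟨f, ⟨⟨plt_of_plt_of_ple (plt_of_step hg) hf.1, hfU⟩, fun x hx => ?_⟩, hX⟩
      obtain ⟨g', hg', h⟩ := plt_iff_step.1 hx.1
      obtain rfl := step_unique hg hg'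
      refine hmin x ⟨⟨h, ?_⟩, hx.2⟩
      rintro rfl
      exact hU hx.2

namespace Trackable

/-- The recursion `MSC.minIn_plt_iff` is a local constraint. It has exactly one solution, by
induction starting from the end of the process in direction `b`. -/
theorem minIn_plt (b : Bool) {U X : EventPred P Sig C} (hU : Trackable U) (hX : Trackable X) :
    Trackable (fun M c e => M.MinIn b (fun f => M.plt b e f ∧ U M c f) (X M c)) := by
  have hU' := hU.comap (Prod.fst : C × Prop → C)
  have hX' := hX.comap (Prod.fst : C × Prop → C)
  have hY : Trackable (fun _ c e => (c e).2 : EventPred P Sig (C × Prop)) := color Prod.snd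
  refine of_guess (B := Prop) id (hY.comb₂ (((hU'.and hX').or (hU'.not.and hY)).step b)
    fun _ _ _ x y => x ↔ y).forall_recognizable (fun M c =>
      ⟨fun e => M.MinIn b (fun f => M.plt b e f ∧ U M c f) (X M c), fun e => MSC.minIn_plt_iff⟩)
    fun M c y hy e => ?_
  induction e using (MSC.wellFounded_plt M (!b)).induction with
  | _ e ih =>
    refine (hy e).trans (Iff.trans ?_ MSC.minIn_plt_iff.symm)
    refine exists_congr fun f => and_congr_right fun hf => ?_
    have := ih f (MSC.plt_not.2 (MSC.plt_of_step hf))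
    exact or_congr Iff.rfl (and_congr Iff.rfl this)

theorem exists_plt (b : Bool) {U : EventPred P Sig C} (hU : Trackable U) :
    Trackable (fun M c e => ∃ f, M.plt b e f ∧ U M c f) :=
  (minIn_plt b hU (const True)).congr fun M _ e =>
    (MSC.minIn_true (q := M.loc e) (fun _ h => (MSC.ple_loc h.1.1).symm) fun _ => trivial).symm

/-- The events of `U` beyond which, in direction `b`, there is no event of `U`. -/
theorem extremal (b : Bool) {U X : EventPred P Sig C} (hU : Trackable U) (hX : Trackable X) :
    Trackable (fun M c f => (U M c f ∧ X M c f) ∧ ¬ ∃ g, M.plt b f g ∧ U M c g) :=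
  (hU.and hX).and (exists_plt b hU).not

end Trackable

/-- Within `U`, the set `S` is closed under moving in direction `!b`. Hence being least among the
events of `S` and `U` amounts to having no event of `U` beyond in direction `!b`, a condition free
of `S`. -/
theorem MSC.minIn_iff_extremal {M : MSC P Sig} {b : Bool} {S U X : M.E → Prop} {q : P}
    (hq : ∀ f, S f → M.loc f = q) (hS : ∀ f g, S f → M.plt (!b) f g → U g → S g) :
    M.MinIn b (fun f => S f ∧ U f) X ↔
      ∃ f, S f ∧ (U f ∧ X f) ∧ ¬ ∃ g, M.plt (!b) f g ∧ U g := by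
  constructor
  · rintro ⟨f, ⟨⟨hf, hU⟩, hmin⟩, hX⟩
    refine ⟨f, hf, ⟨hU, hX⟩, ?_⟩
    rintro ⟨g, hg, hgU⟩
    exact not_plt_of_ple (hmin g ⟨hS f g hf hg hgU, hgU⟩) (plt_not.1 hg)
  · rintro ⟨f, hf, ⟨hU, hX⟩, h⟩
    exact ⟨f, ⟨⟨hf, hU⟩, fun g hg => ple_of_not_plt ((hq f hf).trans (hq g hg.1).symm)
      fun h' => h ⟨g, plt_not.2 h', hg.2⟩⟩, hX⟩

namespace Trackable

theorem minIn_plt' (b b' : Bool) {U X : EventPred P Sig C} (hU : Trackable U) (hX : Trackable X) :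
    Trackable (fun M c e => M.MinIn b' (fun f => M.plt b e f ∧ U M c f) (X M c)) := by
  by_cases h : b' = b
  · subst h
    exact minIn_plt _ hU hX
  · obtain rfl : b = !b' := by cases b <;> cases b' <;> simp_all
    refine (exists_plt (!b') (extremal (!b') hU hX)).congr fun M c e => ?_
    exact MSC.minIn_iff_extremal (q := M.loc e) (fun f hf => (MSC.ple_loc hf.1).symm)
      fun f g hf hg _ => MSC.plt_of_plt_of_ple hf hg.1

/-- The guess is constant along each process. At the last event of a process, `hZ` tells whether the
process has an event in `U`; the acceptance condition sees all last events together and compares the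
guesses with the disjunction of these values. -/
theorem exists_event {U : EventPred P Sig C} (hU : Trackable U) :
    Trackable (fun M c _ => ∃ f, U M c f) := by
  have hZ := hU.or (exists_plt false hU)
  refine of_guess (B := Prop) id ((Recognizable.proc (fun x : C × Prop => x.2) fun x y => x ↔ y).and
    (Recognizable.subst (hZ.comap (Prod.fst : C × Prop → C))
      (Recognizable.acc (fun x : (C × Prop) × Prop => (x.1.2, x.2)) fun σ =>
        ∀ p x, σ p = some x → (x.1 ↔ ∃ q y, σ q = some y ∧ y.2)))) ?_ ?_
  all_goals
    intro M c
    have key : ∀ y : M.E → Prop, (∃ q z, M.last (fun e => (y e, (U M c e ∨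
        ∃ f, M.plt false e f ∧ U M c f))) q = some z ∧ z.2) ↔ ∃ f, U M c f := by
      intro y
      constructor
      · rintro ⟨q, z, hz, h⟩
        obtain ⟨e, -, -, rfl⟩ := MSC.last_eq_some_iff.1 hz
        rcases h with h | ⟨f, -, h⟩
        exacts [⟨e, h⟩, ⟨f, h⟩]
      · rintro ⟨f, hf⟩
        obtain ⟨e, he, hl⟩ := MSC.exists_last f
        refine ⟨M.loc e, _, MSC.last_eq_some_iff.2 ⟨e, rfl, hl, rfl⟩, ?_⟩
        by_cases h : e = f
        · exact Or.inl (h ▸ hf)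
        · exact Or.inr ⟨f, ⟨(MSC.ple_not (b := true)).2 he, h⟩, hf⟩
  · refine ⟨fun _ => ∃ f, U M c f, fun _ _ _ => Iff.rfl, fun p x hx => ?_⟩
    refine Iff.trans ?_ (key _).symm
    obtain ⟨e, -, -, rfl⟩ := MSC.last_eq_some_iff.1 hx
    exact Iff.rfl
  · rintro y ⟨hproc, hacc⟩ e
    obtain ⟨l, hl, hlast⟩ := MSC.exists_last e
    have hy : ∀ l, M.ple true e l → (y e ↔ y l) := by
      intro l hl
      induction hl with
      | refl => rfl
      | tail _ h ih => exact ih.trans (hproc _ _ (by simpa [MSC.step] using h))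
    refine (hy l hl).trans (Iff.trans ?_ (key y))
    exact hacc (M.loc l) _ (MSC.last_eq_some_iff.2 ⟨l, rfl, hlast, rfl⟩)

end Trackable

end

/-! ### Tame relations: composition, converse and complement -/

section

/-- Binary relations between the events of coloured charts. -/
abbrev EventRel (P Sig : Type u) (C : Type) := ∀ M : MSC P Sig, (M.E → C) → M.E → M.E → Prop

namespace EventRel

variable {P Sig : Type u} {C : Type}

/-- The converse of a relation. -/
def swap (R : EventRel P Sig C) : EventRel P Sig C := fun M c e f => R M c f e

/-- The composition of two relations. -/
def comp (R S : EventRel P Sig C) : EventRel P Sig C := fun M c e f => ∃ g, R M c e g ∧ S M c g f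

/-- The pairs `(e, f)` of the domain and the range of `R` such that `f` strictly precedes, in
direction `b`, all events related to `e`. -/
def below (b : Bool) (R : EventRel P Sig C) : EventRel P Sig C := fun M c e f =>
  (∃ g, R M c e g) ∧ (∃ g, R M c g f) ∧ ∀ g, R M c e g → M.plt b f g

/-- For each trackable `U` and `X`, it is trackable whether the least event of `U` that is related
to the given one satisfies `X`. -/
def MinTrackable (b : Bool) (R : EventRel P Sig C) : Prop :=
  ∀ ⦃C' : Type⦄ (h : C' → C) ⦃U X : EventPred P Sig C'⦄, Trackable U → Trackable X →
    Trackable (fun M c e => M.MinIn b (fun f => R M (fun x => h (c x)) e f ∧ U M c f) (X M c))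

/-- A relation between the events of process `p` and those of process `q` that is a sublattice
of the product of the two processes and whose minima and maxima are trackable. -/
structure Tame (p q : P) (R : EventRel P Sig C) : Prop where
  loc : ∀ {M c e f}, R M c e f → M.loc e = p ∧ M.loc f = q
  lattice : ∀ {M c e e' f f'}, M.ple true e e' → M.ple true f f' → R M c e f' → R M c e' f →
    R M c e f ∧ R M c e' f'
  min : ∀ b, MinTrackable b R
  min_swap : ∀ b, MinTrackable b R.swap

theorem MinTrackable.exists_rel {b : Bool} {R : EventRel P Sig C} (hR : MinTrackable b R) {q : P}
    (hq : ∀ {M c e f}, R M c e f → M.loc f = q) {C' : Type} (h : C' → C)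
    {U : EventPred P Sig C'} (hU : Trackable U) :
    Trackable (fun M c e => ∃ f, R M (fun x => h (c x)) e f ∧ U M c f) :=
  (hR h hU (Trackable.const True)).congr fun _ _ _ =>
    (MSC.minIn_true (fun _ h => hq h.1) fun _ => trivial).symm

theorem minTrackable_of_unique {R : EventRel P Sig C}
    (hu : ∀ {M c e f g}, R M c e f → R M c e g → f = g)
    (hR : ∀ {C' : Type} (h : C' → C) {U : EventPred P Sig C'}, Trackable U →
      Trackable (fun M c e => ∃ f, R M (fun x => h (c x)) e f ∧ U M c f)) (b : Bool) :
    MinTrackable b R := fun _ h _ _ hU hX =>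
  (hR h (hU.and hX)).congr fun _ _ _ =>
    (MSC.minIn_of_unique fun _ _ h h' => hu h.1 h'.1).trans
      (exists_congr fun _ => and_assoc)

namespace Tame

variable {p q r : P} {R S : EventRel P Sig C}

theorem swap (hR : Tame p q R) : Tame q p R.swap where
  loc h := (hR.loc h).symm
  lattice h h' hef hfe := hR.lattice h' h hfe hef
  min := hR.min_swap
  min_swap := hR.min

/-- The sublattice condition is invariant under reversing both chains. -/
theorem crossing (hR : Tame p q R) (b : Bool) {M : MSC P Sig} {c : M.E → C} {e e' f f' : M.E}
    (he : M.ple b e e') (hf : M.ple b f f') (h : R M c e f') (h' : R M c e' f) :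
    R M c e f ∧ R M c e' f' := by
  cases b
  · exact (hR.lattice (MSC.ple_not (b := false).2 he) (MSC.ple_not (b := false).2 hf) h' h).symm
  · exact hR.lattice he hf h h'

theorem exists_rel (hR : Tame p q R) {C' : Type} (h : C' → C) {U : EventPred P Sig C'}
    (hU : Trackable U) : Trackable (fun M c e => ∃ f, R M (fun x => h (c x)) e f ∧ U M c f) :=
  MinTrackable.exists_rel (hR.min true) (fun h => (hR.loc h).2) h hU

theorem dom (hR : Tame p q R) {C' : Type} (h : C' → C) :
    Trackable (fun M c e => ∃ f, R M (fun x => h (c x)) e f : EventPred P Sig C') :=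
  (hR.exists_rel h (Trackable.const True)).congr fun _ _ _ => by simp

theorem exists_min (hR : Tame p q R) (b : Bool) {M : MSC P Sig} {c : M.E → C} {e f : M.E}
    (h : R M c e f) : ∃ m, R M c e m ∧ ∀ g, R M c e g → M.ple b m g :=
  MSC.exists_min b (fun _ h => (hR.loc h).2) ⟨f, h⟩

/-- The least target is reached through the least admissible intermediate event `g`: a smaller
target reached through a later intermediate event would cross a pair starting in `g`, and would thus
be related to `g` itself. -/
theorem min_comp (hR : Tame p q R) (hS : Tame q r S) (b : Bool) :
    MinTrackable b (R.comp S) := by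
  intro C' h U X hU hX
  refine (hR.min b h (hS.exists_rel h hU) (hS.min b h hU hX)).congr fun M c e => ?_
  generalize (fun x => h (c x)) = c'
  have key : ∀ g f, (R M c' e g ∧ ∃ f, S M c' g f ∧ U M c f) →
      (∀ g', (R M c' e g' ∧ ∃ f, S M c' g' f ∧ U M c f) → M.ple b g g') →
      (S M c' g f ∧ U M c f) → (∀ f', (S M c' g f' ∧ U M c f') → M.ple b f f') →
      (∀ f', (R.comp S M c' e f' ∧ U M c f') → M.ple b f f') := by
    rintro g f ⟨hg, -⟩ hgmin ⟨hf, -⟩ hfmin f' ⟨⟨g', hg', hf'⟩, hU'⟩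
    refine MSC.ple_of_not_plt ((hS.loc hf).2.trans (hS.loc hf').2.symm) fun hlt => ?_
    have := (hS.crossing b (hgmin g' ⟨hg', f', hf', hU'⟩) hlt.1 hf hf').1
    exact MSC.not_plt_of_ple (hfmin f' ⟨this, hU'⟩) hlt
  constructor
  · rintro ⟨f, ⟨⟨⟨g, hg, hf⟩, hUf⟩, hmin⟩, hXf⟩
    obtain ⟨g₀, hg₀, hg₀min⟩ := MSC.exists_min (M := M) b
      (S := fun g => R M c' e g ∧ ∃ f, S M c' g f ∧ U M c f) (fun _ h => (hR.loc h.1).2)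
      ⟨g, hg, f, hf, hUf⟩
    obtain ⟨f₀, hf₀, hf₀min⟩ := MSC.exists_min (M := M) b
      (S := fun f => S M c' g₀ f ∧ U M c f) (fun _ h => (hS.loc h.1).2) hg₀.2
    obtain rfl := MSC.ple_antisymm (key g₀ f₀ hg₀ hg₀min hf₀ hf₀min f ⟨⟨g, hg, hf⟩, hUf⟩)
      (hmin f₀ ⟨⟨g₀, hg₀.1, hf₀.1⟩, hf₀.2⟩)
    exact ⟨g₀, ⟨hg₀, hg₀min⟩, f₀, ⟨hf₀, hf₀min⟩, hXf⟩
  · rintro ⟨g, ⟨hg, hgmin⟩, f, ⟨hf, hfmin⟩, hXf⟩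
    exact ⟨f, ⟨⟨⟨g, hg.1, hf.1⟩, hf.2⟩, key g f hg hgmin hf hfmin⟩, hXf⟩

/-- The two intermediate events are comparable. Depending on their order, the `S`-parts or the
`R`-parts of the two connections cross and can be exchanged. -/
theorem comp (hR : Tame p q R) (hS : Tame q r S) : Tame p r (R.comp S) where
  loc := fun ⟨_, hg, hf⟩ => ⟨(hR.loc hg).1, (hS.loc hf).2⟩
  lattice := by
    rintro M c e e' f f' he hf ⟨g, hg, hgf⟩ ⟨g', hg', hgf'⟩
    rcases MSC.ple_total (b := true) ((hR.loc hg).2.trans (hR.loc hg').2.symm) with h | h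
    · have := hS.lattice h hf hgf hgf'
      exact ⟨⟨g, hg, this.1⟩, ⟨g', hg', this.2⟩⟩
    · have := hR.lattice he h hg hg'
      exact ⟨⟨g', this.1, hgf'⟩, ⟨g, this.2, hgf⟩⟩
  min := hR.min_comp hS
  min_swap b := by
    have : (R.comp S).swap = S.swap.comp R.swap := by
      funext M c e f
      exact propext (exists_congr fun _ => and_comm)
    rw [this]
    exact hS.swap.min_comp hR.swap b

/-- Let `m` be the first image of `e` in direction `b`. The events wanted are those of the range
strictly before `m`, so the search starts in `m` and goes in direction `!b`. -/
theorem min_below (hR : Tame p q R) (b b' : Bool) : MinTrackable b' (R.below b) := by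
  intro C' h U X hU hX
  refine (hR.min b h (Trackable.const True)
    (Trackable.minIn_plt' (!b) b' ((hR.swap.dom h).and hU) hX)).congr fun M c e => ?_
  generalize hc : (fun x => h (c x)) = c'
  have key : ∀ m, R M c' e m → (∀ g, R M c' e g → M.ple b m g) →
      (fun f => R.below b M c' e f ∧ U M c f) = fun f => M.plt (!b) m f ∧
        (∃ g, R.swap M (fun x => h (c x)) f g) ∧ U M c f := by
    intro m hm hmin
    funext f
    rw [hc]
    refine propext ⟨fun h => ⟨MSC.plt_not.2 (h.1.2.2 m hm), h.1.2.1, h.2⟩, fun h => ?_⟩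
    exact ⟨⟨⟨m, hm⟩, h.2.1, fun g hg => MSC.plt_of_plt_of_ple (MSC.plt_not.1 h.1) (hmin g hg)⟩,
      h.2.2⟩
  constructor
  · rintro ⟨f, hf, hX⟩
    obtain ⟨g, hg⟩ := hf.1.1.1
    obtain ⟨m, hm, hmin⟩ := hR.exists_min b hg
    refine ⟨m, ⟨⟨hm, trivial⟩, fun g hg => hmin g hg.1⟩, ?_⟩
    have := key m hm hmin
    rw [hc] at this
    beta_reduce
    rw [← this]
    exact ⟨f, hf, hX⟩
  · rintro ⟨m, ⟨⟨hm, -⟩, hmin⟩, h⟩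
    have := key m hm fun g hg => hmin g ⟨hg, trivial⟩
    rw [hc] at this
    rwa [← this] at h

/-- If some preimage `g` of `f` did not come strictly before `e`, the pairs `(e, m)` and `(g, f)`
would cross and relate `e` to `f`, which precedes all images of `e`. Thus the converse of a relation
`below` has the same form. -/
theorem below_swap_of_below (hR : Tame p q R) {b : Bool} {M : MSC P Sig} {c : M.E → C}
    {e f : M.E} (h : R.below b M c e f) : R.swap.below (!b) M c f e := by
  refine ⟨h.2.1, h.1, fun g hg => MSC.plt_not.2 ?_⟩
  obtain ⟨⟨m, hm⟩, -, hlt⟩ := h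
  by_contra hge
  have hle := MSC.ple_of_not_plt ((hR.loc hm).1.trans (hR.loc hg).1.symm) hge
  exact MSC.plt_irrefl _ (hlt f (hR.crossing b hle (hlt m hm).1 hm hg).1)

theorem below (hR : Tame p q R) (b : Bool) : Tame p q (R.below b) where
  loc := fun ⟨⟨_, h⟩, ⟨_, h'⟩, _⟩ => ⟨(hR.loc h).1, (hR.loc h').2⟩
  lattice := by
    suffices H : ∀ {M : MSC P Sig} {c : M.E → C} {e e' f f' : M.E}, M.ple b e e' → M.ple b f f' →
        R.below b M c e f' → R.below b M c e' f → R.below b M c e f ∧ R.below b M c e' f' by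
      cases b
      · intro M c e e' f f' he hf h h'
        exact (H (MSC.ple_not (b := true).2 he) (MSC.ple_not (b := true).2 hf) h' h).symm
      · intro M c e e' f f' he hf h h'
        exact H he hf h h'
    rintro M c e e' f f' he hf ⟨h₁, h₂, h₃⟩ ⟨h₁', h₂', h₃'⟩
    refine ⟨⟨h₁, h₂', fun g hg => MSC.plt_of_ple_of_plt hf (h₃ g hg)⟩, h₁', h₂, fun g hg => ?_⟩
    obtain ⟨m, hm⟩ := h₁
    obtain ⟨x, hx⟩ := h₂
    by_contra hge
    have hle := MSC.ple_of_not_plt ((hR.loc hg).2.trans (hR.loc hx).2.symm) hge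
    exact hge (h₃ g (hR.crossing b he (MSC.ple_trans hle (h₃ m hm).1) hm hg).1)
  min := hR.min_below b
  min_swap b' := by
    have : (R.below b).swap = R.swap.below (!b) := by
      funext M c e f
      refine propext ⟨hR.below_swap_of_below, fun h => ?_⟩
      have := hR.swap.below_swap_of_below h
      rwa [Bool.not_not] at this
    rw [this]
    exact hR.swap.min_below _ _

/-- If `f` has a preimage `x` and lies between two images of `e`, then a crossing relates `e` to
`f`, whichever of `e` and `x` comes first. So the complement is a union of tame relations and of
conditions on one event. -/
theorem not_rel_iff (hR : Tame p q R) {M : MSC P Sig} {c : M.E → C} {e f : M.E} :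
    ¬ R M c e f ↔ (¬ ∃ g, R M c e g) ∨ (¬ ∃ g, R M c g f) ∨ R.below true M c e f ∨
      R.below false M c e f := by
  constructor
  · intro h
    by_contra hcon
    simp only [not_or, not_not] at hcon
    obtain ⟨h₁, h₂, h₃, h₄⟩ := hcon
    replace h₃ : ¬ ∀ g, R M c e g → M.plt true f g := fun H => h₃ ⟨h₁, h₂, H⟩
    replace h₄ : ¬ ∀ g, R M c e g → M.plt false f g := fun H => h₄ ⟨h₁, h₂, H⟩
    push Not at h₃ h₄
    obtain ⟨m, hm, hmf⟩ := h₃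
    obtain ⟨m', hm', hmf'⟩ := h₄
    obtain ⟨x, hx⟩ := h₂
    have hmf := MSC.ple_of_not_plt ((hR.loc hm).2.trans (hR.loc hx).2.symm) hmf
    have hmf' := MSC.ple_of_not_plt ((hR.loc hm').2.trans (hR.loc hx).2.symm) hmf'
    rcases MSC.ple_total (b := true) ((hR.loc hm).1.trans (hR.loc hx).1.symm) with hex | hex
    · exact h (hR.lattice hex (MSC.ple_not (b := true).1 hmf') hm' hx).1
    · exact h (hR.lattice hex hmf hx hm).2
  · rintro (h | h | h | h) hef
    · exact h ⟨f, hef⟩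
    · exact h ⟨e, hef⟩
    · exact MSC.plt_irrefl _ (h.2.2 f hef)
    · exact MSC.plt_irrefl _ (h.2.2 f hef)

end Tame

end EventRel

/-! ### Events related to themselves -/

/-- A partial function that descends along a well-founded relation has a proper 2-colouring. -/
theorem exists_proper_coloring {α : Type v} {r H : α → α → Prop} (wf : WellFounded r)
    (hH : ∀ {a x y}, H a x → H a y → x = y) (hr : ∀ {a x}, H a x → r x a) :
    ∃ g : α → Prop, ∀ a x, H a x → (g a ↔ ¬ g x) := by
  refine ⟨wf.fix fun a ih => ∃ (x : α) (h : H a x), ¬ ih x (hr h), fun a x hx => ?_⟩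
  conv_lhs => rw [wf.fix_eq]
  exact ⟨fun ⟨y, hy, h⟩ => hH hx hy ▸ h, fun h => ⟨x, hx, h⟩⟩

namespace EventRel.Tame

variable {P Sig : Type u} {C : Type} {p q r : P} {R S : EventRel P Sig C}

/-- If the least images were in the wrong order, the pairs would cross and the smaller image would
belong to both events. -/
theorem min_mono (hR : Tame p q R) (b : Bool) {M : MSC P Sig} {c : M.E → C} {e e' m m' : M.E}
    (he : M.ple b e e') (hm : R M c e m ∧ ∀ g, R M c e g → M.ple true m g)
    (hm' : R M c e' m' ∧ ∀ g, R M c e' g → M.ple true m' g) : M.ple b m m' := by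
  suffices H : ∀ {e e' m m' : M.E}, M.ple true e e' →
      (R M c e m ∧ ∀ g, R M c e g → M.ple true m g) →
      (R M c e' m' ∧ ∀ g, R M c e' g → M.ple true m' g) → M.ple true m m' by
    cases b
    · exact MSC.ple_not (b := true).2 (H (MSC.ple_not (b := true).1 he) hm' hm)
    · exact H he hm hm'
  intro e e' m m' he hm hm'
  refine MSC.ple_of_not_plt ((hR.loc hm.1).2.trans (hR.loc hm'.1).2.symm) fun hlt => ?_
  exact MSC.not_plt_of_ple (hm.2 _ (hR.lattice he hlt.1 hm.1 hm'.1).1) hlt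

/-- The set of the events `e` for which the least event `m` related to `e` satisfies `¬ T m e` has
a recognizable certificate, if `T m` is closed under going on in direction `b` and `T` is compatible
with the order. The certificate consists of the set and of a colouring of it: passing from `e` to
the first event `f` of the set with `T m f` changes the colour. -/
theorem exists_certificate (hR : Tame p p R) (b : Bool)
    (T : ∀ M : MSC P Sig, M.E → M.E → Prop)
    (hT : ∀ {C' : Type} {U X : EventPred P Sig C'}, Trackable U → Trackable X →
      Trackable (fun M c m => M.MinIn b (fun f => T M m f ∧ U M c f) (X M c)))
    (hloc : ∀ {M m f}, T M m f → M.loc m = M.loc f)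
    (hup : ∀ {M m f f'}, T M m f → M.ple b f f' → T M m f')
    (hdown : ∀ {M m m' f}, T M m' f → M.ple b m m' → T M m f) :
    ∃ K : ∀ M : MSC P Sig, (M.E → C × Prop × Prop) → Prop, Recognizable K ∧
      (∀ (M : MSC P Sig) (c : M.E → C), ∃ g : M.E → Prop,
        K M fun e => (c e, M.MinIn true (fun m => R M c e m ∧ True) (fun m => ¬ T M m e), g e)) ∧
      ∀ (M : MSC P Sig) (c : M.E → C) (a g : M.E → Prop), (K M fun e => (c e, a e, g e)) →
        ∀ e, a e → M.MinIn true (fun m => R M c e m ∧ True) (fun m => ¬ T M m e) := by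
  have ha : Trackable (fun _ x e => (x e).2.1 : EventPred P Sig (C × Prop × Prop)) :=
    Trackable.color fun x : C × Prop × Prop => x.2.1
  have hg : Trackable (fun _ x e => (x e).2.2 : EventPred P Sig (C × Prop × Prop)) :=
    Trackable.color fun x : C × Prop × Prop => x.2.2
  -- With `m` the least image of `e`, this evaluates `X` at the first marked event `f` in direction
  -- `b` such that `T M m f`.
  have hQ : ∀ {X : EventPred P Sig (C × Prop × Prop)}, Trackable X →
      Trackable (fun M x e => M.MinIn true (fun m => R M (fun y => (x y).1) e m ∧ True)
        (fun m => M.MinIn b (fun f => T M m f ∧ (x f).2.1) (X M x))) := fun hX =>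
    hR.min true Prod.fst (Trackable.const True) (hT ha hX)
  -- Every marked event lies in the domain, and that event `f`, if it exists, has the other colour.
  refine ⟨_, (ha.imp ((hR.dom Prod.fst).and (((hQ hg).imp hg.not).and
    ((hQ hg.not).imp hg)))).forall_recognizable, fun M c => ?_, fun M c a g hK e he => ?_⟩
  · let A : M.E → Prop := fun e => M.MinIn true (fun m => R M c e m ∧ True) (fun m => ¬ T M m e)
    have hex : ∃ g : M.E → Prop, ∀ e f,
        (A e ∧ ∃ m, (R M c e m ∧ ∀ m', R M c e m' → M.ple true m m') ∧
        (T M m f ∧ A f) ∧ ∀ f', (T M m f' ∧ A f') → M.ple b f f') → (g e ↔ ¬ g f) := by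
      -- As `T m e` fails and `T m` is closed in direction `b`, the event `f` lies strictly beyond
      -- `e`. So the map from `e` to `f` has no cycles, not even loops.
      refine exists_proper_coloring (MSC.wellFounded_plt M (!b)) ?_ ?_
      · rintro e f f' ⟨-, m, hm, hf, hfmin⟩ ⟨-, m', hm', hf', hfmin'⟩
        obtain rfl := MSC.ple_antisymm (hm.2 m' hm'.1) (hm'.2 m hm.1)
        exact MSC.ple_antisymm (hfmin f' hf') (hfmin' f hf)
      · rintro e f ⟨⟨m', hm', hT'⟩, m, hm, hf, -⟩
        obtain rfl := MSC.ple_antisymm (hm.2 m' hm'.1.1) (hm'.2 m ⟨hm.1, trivial⟩)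
        have hl := (hR.loc hm.1).1.trans ((hR.loc hm.1).2.symm.trans (hloc hf.1))
        by_contra hlt
        exact hT' (hup hf.1 (MSC.ple_of_not_plt hl.symm fun h => hlt (MSC.plt_not.2 h)))
    obtain ⟨g, hg⟩ := hex
    refine ⟨g, fun e he => ⟨?_, ?_, ?_⟩⟩
    · obtain ⟨m, hm, -⟩ := he
      exact ⟨m, hm.1.1⟩
    · rintro ⟨m, hm, f, hf, hgf⟩ hge
      exact (hg e f ⟨he, m, ⟨hm.1.1, fun m' h => hm.2 m' ⟨h, trivial⟩⟩, hf⟩).1 hge hgf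
    · rintro ⟨m, hm, f, hf, hgf⟩
      exact (hg e f ⟨he, m, ⟨hm.1.1, fun m' h => hm.2 m' ⟨h, trivial⟩⟩, hf⟩).2 hgf
  -- Suppose `T m e`. The first marked `f` with `T m f` is not `e`, by the colours, so it comes
  -- before `e` in direction `b`. By monotonicity its least image `m₀` does not lie beyond `m`,
  -- whence `T m₀ f`, against the induction hypothesis.
  · induction e using (MSC.wellFounded_plt M b).induction with
    | _ e ih =>
      obtain ⟨⟨x, hx⟩, h₁, h₂⟩ := hK e he
      obtain ⟨m, hm, hmin⟩ := hR.exists_min true hx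
      have hm' : (R M c e m ∧ True) ∧ ∀ g, (R M c e g ∧ True) → M.ple true m g :=
        ⟨⟨hm, trivial⟩, fun g hg => hmin g hg.1⟩
      refine ⟨m, hm', fun hTe => ?_⟩
      obtain ⟨f, hf, hfmin⟩ := MSC.exists_min (M := M) b (S := fun f => T M m f ∧ a f)
        (fun f h => (hloc h.1).symm) ⟨e, hTe, he⟩
      by_cases hfe : f = e
      · subst hfe
        by_cases hg : g f
        · exact h₁ ⟨m, hm', f, ⟨hf, hfmin⟩, hg⟩ hg
        · exact hg (h₂ ⟨m, hm', f, ⟨hf, hfmin⟩, hg⟩)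
      · have hle := hfmin e ⟨hTe, he⟩
        obtain ⟨m₀, ⟨hm₀, hmin₀⟩, hT₀⟩ := ih f ⟨hle, hfe⟩ hf.2
        exact hT₀ (hdown hf.1 (hR.min_mono b hle ⟨hm₀.1, fun g hg => hmin₀ g ⟨hg, trivial⟩⟩
          ⟨hm, hmin⟩))

theorem minIn_ple_iff {M : MSC P Sig} {b : Bool} {U X : M.E → Prop} {e : M.E} :
    M.MinIn b (fun f => M.ple b e f ∧ U f) X ↔
      (U e ∧ X e) ∨ (¬ U e ∧ M.MinIn b (fun f => M.plt b e f ∧ U f) X) := by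
  constructor
  · rintro ⟨f, ⟨⟨hf, hU⟩, hmin⟩, hX⟩
    by_cases he : U e
    · obtain rfl := MSC.ple_antisymm hf (hmin e ⟨MSC.ple_refl _, he⟩)
      exact Or.inl ⟨he, hX⟩
    · refine Or.inr ⟨he, f, ⟨⟨⟨hf, ?_⟩, hU⟩, fun g hg => hmin g ⟨hg.1.1, hg.2⟩⟩, hX⟩
      rintro rfl
      exact he hU
  · rintro (⟨hU, hX⟩ | ⟨he, f, ⟨⟨hf, hU⟩, hmin⟩, hX⟩)
    · exact ⟨e, ⟨⟨MSC.ple_refl _, hU⟩, fun g hg => hg.1⟩, hX⟩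
    · refine ⟨f, ⟨⟨hf.1, hU⟩, fun g hg => hmin g ⟨⟨hg.1, ?_⟩, hg.2⟩⟩, hX⟩
      rintro rfl
      exact he hg.2

theorem trackable_minIn_ple (b b' : Bool) {U X : EventPred P Sig C} (hU : Trackable U)
    (hX : Trackable X) :
    Trackable (fun M c e => M.MinIn b' (fun f => M.ple b e f ∧ U M c f) (X M c)) := by
  by_cases h : b' = b
  · subst h
    exact ((hU.and hX).or (hU.not.and (Trackable.minIn_plt _ hU hX))).congr fun M c e =>
      minIn_ple_iff
  · obtain rfl : b = !b' := by cases b <;> cases b' <;> simp_all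
    have hW := Trackable.extremal (!b') hU hX
    refine (hW.or (Trackable.exists_plt (!b') hW)).congr fun M c e => ?_
    refine (MSC.minIn_iff_extremal (q := M.loc e) (fun f hf => (MSC.ple_loc hf).symm)
      fun f g hf hg _ => MSC.ple_trans hf hg.1).trans ⟨?_, ?_⟩
    · rintro ⟨f, hf, h⟩
      by_cases hef : e = f
      · exact Or.inl (hef ▸ h)
      · exact Or.inr ⟨f, ⟨hf, hef⟩, h⟩
    · rintro (h | ⟨f, hf, h⟩)
      · exact ⟨e, MSC.ple_refl _, h⟩
      · exact ⟨f, hf.1, h⟩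

/-- It is trackable whether the least event related to `e` comes strictly after `e`. -/
theorem trackable_lt_min (hR : Tame p p R) :
    Trackable (fun M c e => M.MinIn true (fun m => R M c e m ∧ True)
      (fun m => ¬ M.ple true m e)) := by
  -- The first certificate proves `e < m` on its set, the second proves `m ≤ e`. Neither shows that
  -- its set is complete, but asking the two sets to cover the domain determines both.
  obtain ⟨K, hK, hKex, hKsound⟩ := hR.exists_certificate true (fun M => M.ple true)
    (trackable_minIn_ple true true) MSC.ple_loc MSC.ple_trans fun h h' => MSC.ple_trans h' h
  obtain ⟨L, hL, hLex, hLsound⟩ := hR.exists_certificate false (fun M => M.plt false)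
    (Trackable.minIn_plt' false false) (fun h => MSC.ple_loc h.1) MSC.plt_of_plt_of_ple
    fun h h' => MSC.plt_of_ple_of_plt h' h
  refine Trackable.of_guess (B := (Prop × Prop) × Prop × Prop) (fun b => b.1.1)
    ((hK.comap fun x : C × (Prop × Prop) × Prop × Prop => (x.1, x.2.1)).and
    ((hL.comap fun x : C × (Prop × Prop) × Prop × Prop => (x.1, x.2.2)).and
      ((hR.dom Prod.fst).imp (Trackable.color fun x : C × (Prop × Prop) × Prop × Prop =>
        x.2.1.1 ∨ x.2.2.1)).forall_recognizable)) (fun M c => ?_) fun M c b hb e => ?_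
  · obtain ⟨g, hg⟩ := hKex M c
    obtain ⟨g', hg'⟩ := hLex M c
    refine ⟨fun e => ((_, g e), (_, g' e)), hg, hg', fun e he => ?_⟩
    obtain ⟨x, hx⟩ := he
    obtain ⟨m, hm, hmin⟩ := hR.exists_min true hx
    by_cases h : M.ple true m e
    · exact Or.inr ⟨m, ⟨⟨hm, trivial⟩, fun g hg => hmin g hg.1⟩, fun h' =>
        MSC.not_plt_of_ple h (MSC.plt_not (b := true).1 h')⟩
    · exact Or.inl ⟨m, ⟨⟨hm, trivial⟩, fun g hg => hmin g hg.1⟩, h⟩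
  · obtain ⟨h₁, h₂, h₃⟩ := hb
    refine ⟨hKsound M c _ _ h₁ e, fun ⟨m, hm, hme⟩ => ?_⟩
    refine (h₃ e ⟨m, hm.1.1⟩).resolve_right fun h => ?_
    obtain ⟨m', hm', h'⟩ := hLsound M c _ _ h₂ e h
    obtain rfl := MSC.ple_antisymm (hm.2 m' hm'.1) (hm'.2 m hm.1)
    refine hme (MSC.ple_of_not_plt ?_ fun hlt => h' (MSC.plt_not (b := true).2 hlt))
    exact (hR.loc hm.1.1).2.trans (hR.loc hm.1.1).1.symm

/-- Let `m` be the least image and `m'` the least preimage of `e`. If both are at most `e`, then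
`(e, e)` is the join of the related pairs `(m', e)` and `(e, m)`. -/
theorem trackable_loop (hR : Tame p p R) : Trackable (fun M c e => R M c e e) := by
  refine (((hR.dom id).and (hR.swap.dom id)).and (hR.trackable_lt_min.not.and
    hR.swap.trackable_lt_min.not)).congr fun M c e => ⟨fun h => ⟨⟨⟨e, h⟩, ⟨e, h⟩⟩, ?_, ?_⟩, ?_⟩
  · rintro ⟨m, hm, h'⟩
    exact h' (hm.2 e ⟨h, trivial⟩)
  · rintro ⟨m, hm, h'⟩
    exact h' (hm.2 e ⟨h, trivial⟩)
  · rintro ⟨⟨⟨x, hx⟩, ⟨y, hy⟩⟩, h₁, h₂⟩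
    obtain ⟨m, hm, hmin⟩ := hR.exists_min true hx
    obtain ⟨m', hm', hmin'⟩ := hR.swap.exists_min true hy
    have h₁ : M.ple true m e := by
      by_contra h
      exact h₁ ⟨m, ⟨⟨hm, trivial⟩, fun g hg => hmin g hg.1⟩, h⟩
    have h₂ : M.ple true m' e := by
      by_contra h
      exact h₂ ⟨m', ⟨⟨hm', trivial⟩, fun g hg => hmin' g hg.1⟩, h⟩
    exact (hR.lattice h₂ h₁ hm' hm).2

/-! ### The basic tame relations -/

/-- The identity on the events of process `p` that satisfy `V`. -/
theorem test (p : P) {V : EventPred P Sig C} (hV : Trackable V) :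
    Tame p p (fun M c e f => e = f ∧ M.loc e = p ∧ V M c e) := by
  have key : ∀ b, MinTrackable b (fun M c e f => e = f ∧ M.loc e = p ∧ V M c e) :=
    minTrackable_of_unique (fun h h' => h.1.symm.trans h'.1) fun h U hU =>
      ((Trackable.loc p).and ((hV.comap h).and hU)).congr fun M c e =>
        ⟨fun ⟨f, ⟨hf, hp, hv⟩, hu⟩ => ⟨hp, hv, hf ▸ hu⟩, fun ⟨hp, hv, hu⟩ => ⟨e, ⟨rfl, hp, hv⟩, hu⟩⟩
  refine ⟨fun h => ⟨h.2.1, h.1 ▸ h.2.1⟩, ?_, key, fun b => ?_⟩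
  · rintro M c e e' f f' he hf ⟨rfl, h⟩ ⟨rfl, h'⟩
    obtain rfl := MSC.ple_antisymm he hf
    exact ⟨⟨rfl, h⟩, ⟨rfl, h⟩⟩
  · have : (EventRel.swap fun M c e f => e = f ∧ M.loc e = p ∧ V M c e : EventRel P Sig C) =
        fun M c e f => e = f ∧ M.loc e = p ∧ V M c e := by
      funext M c e f
      exact propext ⟨fun ⟨h, h'⟩ => ⟨h.symm, h ▸ h'⟩, fun ⟨h, h'⟩ => ⟨h.symm, h ▸ h'⟩⟩
    rw [this]
    exact key b

theorem proc (p : P) : Tame p p (fun M _ e f => M.loc e = p ∧ M.proc e f : EventRel P Sig C) where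
  loc h := ⟨h.1, (MSC.loc_eq_of_proc _ _ _ h.2) ▸ h.1⟩
  lattice := by
    rintro M c e e' f f' he hf ⟨hl, h⟩ ⟨hl', h'⟩
    by_cases hee : e = e'
    · subst hee
      obtain rfl := MSC.proc_unique_right h h'
      exact ⟨⟨hl, h⟩, ⟨hl, h⟩⟩
    -- If `e < e'`, the successor `f'` of `e` is at most `e'` and hence strictly before `f`, so this
    -- case is void.
    · obtain ⟨g, hg, hge⟩ := MSC.plt_iff_step.1 ⟨he, hee⟩
      obtain rfl := MSC.step_unique (b := true) hg h
      exact absurd (MSC.plt_of_ple_of_plt hge (MSC.plt_of_step (b := true) h'))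
        (MSC.not_plt_of_ple hf)
  min := minTrackable_of_unique (fun h h' => MSC.proc_unique_right h.2 h'.2) fun h U hU =>
    ((Trackable.loc p).and (hU.step true)).congr fun M c e => by
      simp [MSC.step, and_assoc]
  min_swap := minTrackable_of_unique (fun h h' => MSC.proc_unique_left h.2 h'.2) fun h U hU =>
    ((Trackable.loc p).and (hU.step false)).congr fun M c e => by
      simp only [MSC.step]
      constructor
      · rintro ⟨f, ⟨hf, h⟩, hu⟩
        exact ⟨(M.loc_eq_of_proc _ _ h) ▸ hf, f, h, hu⟩
      · rintro ⟨hp, f, h, hu⟩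
        exact ⟨f, ⟨(M.loc_eq_of_proc _ _ h).trans hp, h⟩, hu⟩

theorem msg (p q : P) :
    Tame p q (fun M _ e f => M.loc e = p ∧ M.loc f = q ∧ M.msg e f : EventRel P Sig C) where
  loc h := ⟨h.1, h.2.1⟩
  lattice := by
    rintro M c e e' f f' he hf ⟨hl, hm, h⟩ ⟨hl', hm', h'⟩
    -- FIFO turns `e ≤ e'` into `f' ≤ f`: messages of one channel never cross properly.
    obtain rfl := MSC.ple_antisymm (b := true) hf
      ((M.fifo _ _ _ _ h h' (hl.trans hl'.symm) (hm.trans hm'.symm)).1 he)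
    obtain ⟨rfl, -⟩ := M.msg_unique _ _ _ _ h h' (by simp)
    exact ⟨⟨hl, hm, h⟩, ⟨hl, hm, h⟩⟩
  min := minTrackable_of_unique (fun h h' => (MSC.msg_unique _ _ _ _ _ h.2.2 h'.2.2 (by simp)).2)
    fun h U hU => ((Trackable.loc p).and ((Trackable.loc q).and hU).msg).congr fun M c e =>
      ⟨fun ⟨f, ⟨hp, hq, h⟩, hu⟩ => ⟨hp, f, h, hq, hu⟩, fun ⟨hp, f, h, hq, hu⟩ =>
        ⟨f, ⟨hp, hq, h⟩, hu⟩⟩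
  min_swap := minTrackable_of_unique
    (fun h h' => (MSC.msg_unique _ _ _ _ _ h.2.2 h'.2.2 (by simp)).1)
    fun h U hU => ((Trackable.loc q).and ((Trackable.loc p).and hU).msg_swap).congr fun M c e =>
      ⟨fun ⟨f, ⟨hp, hq, h⟩, hu⟩ => ⟨hq, f, h, hp, hu⟩, fun ⟨hq, f, h, hp, hu⟩ =>
        ⟨f, ⟨hp, hq, h⟩, hu⟩⟩

theorem ple (p : P) :
    Tame p p (fun M _ e f => M.loc e = p ∧ M.ple true e f : EventRel P Sig C) where
  loc h := ⟨h.1, (MSC.ple_loc h.2) ▸ h.1⟩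
  lattice := by
    rintro M c e e' f f' he hf ⟨hl, h⟩ ⟨hl', h'⟩
    exact ⟨⟨hl, MSC.ple_trans he h'⟩, ⟨hl', MSC.ple_trans h' hf⟩⟩
  min b C' h U X hU hX := ((Trackable.loc p).and (trackable_minIn_ple true b hU hX)).congr
    fun M c e => by
      by_cases hp : M.loc e = p
      · simp [hp]
      · simp [hp, MSC.MinIn]
  min_swap b C' h U X hU hX := ((Trackable.loc p).and (trackable_minIn_ple false b hU hX)).congr
    fun M c e => by
      have : (fun f => (M.loc f = p ∧ M.ple true f e) ∧ U M c f) =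
          fun f => M.loc e = p ∧ M.ple false e f ∧ U M c f := by
        funext f
        refine propext ⟨fun ⟨⟨h, h'⟩, h''⟩ =>
            ⟨(MSC.ple_loc h') ▸ h, MSC.ple_not (b := true).2 h', h''⟩,
          fun ⟨h, h', h''⟩ => ⟨⟨(MSC.ple_loc h').symm.trans h, MSC.ple_not (b := true).1 h'⟩, h''⟩⟩
      simp only [EventRel.swap, this]
      by_cases hp : M.loc e = p
      · simp [hp]
      · simp [hp, MSC.MinIn]

end EventRel.Tame

end

/-! ### Disjunctive normal forms and elimination of event quantifiers -/

section

/-- An atomic statement: two events, given by variables, are related by a tame relation. -/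
structure TameAtom (P Sig : Type u) (C : Type) where
  /-- the variable for the first event -/
  src : ℕ
  /-- the variable for the second event -/
  tgt : ℕ
  /-- the process of the first event -/
  p : P
  /-- the process of the second event -/
  q : P
  /-- the relation -/
  R : EventRel P Sig C
  tame : R.Tame p q

/-- A tame relation between an event given by a variable and the events of process `p`. -/
structure TameBranch (P Sig : Type u) (C : Type) (p : P) where
  /-- the variable for the first event -/
  src : ℕ
  /-- the process of the first event -/
  p' : P
  /-- the relation -/
  R : EventRel P Sig C
  tame : R.Tame p' p

/-- Properties of valuations of the event variables in coloured charts. -/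
abbrev ValuationPred (P Sig : Type u) (C : Type) :=
  ∀ M : MSC P Sig, (M.E → C) → (ℕ → M.E) → Prop

variable {P Sig : Type u} {C : Type}

/-- The truth of an atomic statement. -/
def TameAtom.Holds (a : TameAtom P Sig C) : ValuationPred P Sig C := fun M c ν =>
  a.R M c (ν a.src) (ν a.tgt)

/-- Finite disjunctions of finite conjunctions of atomic statements. -/
def IsDNF (Φ : ValuationPred P Sig C) : Prop :=
  ∃ L : List (List (TameAtom P Sig C)), ∀ M c ν, Φ M c ν ↔ ∃ l ∈ L, ∀ a ∈ l, a.Holds M c ν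

theorem EventRel.Tame.trackable_diag {p q : P} {R : EventRel P Sig C} (hR : R.Tame p q) :
    Trackable (fun M c e => R M c e e) := by
  by_cases h : p = q
  · subst h
    exact hR.trackable_loop
  · exact (Trackable.const False).congr fun M c e =>
      ⟨fun h' => h ((hR.loc h').1.symm.trans (hR.loc h').2), False.elim⟩

theorem Trackable.forall_mem {ι : Type v} {U : ι → EventPred P Sig C} (l : List ι)
    (h : ∀ i ∈ l, Trackable (U i)) : Trackable (fun M c e => ∀ i ∈ l, U i M c e) := by
  induction l with
  | nil => exact (Trackable.const True).congr (by simp)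
  | cons a l ih =>
    exact ((h a (by simp)).and (ih fun i hi => h i (by simp [hi]))).congr (by simp)

theorem Trackable.exists_mem {ι : Type v} {U : ι → EventPred P Sig C} (l : List ι)
    (h : ∀ i ∈ l, Trackable (U i)) : Trackable (fun M c e => ∃ i ∈ l, U i M c e) := by
  induction l with
  | nil => exact (Trackable.const False).congr (by simp)
  | cons a l ih =>
    exact ((h a (by simp)).or (ih fun i hi => h i (by simp [hi]))).congr (by simp)

/-- Convex subsets of a chain that meet pairwise have a common element. -/
theorem EventRel.exists_common_iff {p : P} (l : List (TameBranch P Sig C p))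
    {U : EventPred P Sig C} {M : MSC P Sig} {c : M.E → C} {ν : ℕ → M.E}
    (hp : ∀ e, U M c e → M.loc e = p) (hr : ∀ e, U M c e → ∀ a ∈ l, ∃ x, a.R M c x e) :
    (∃ e, U M c e ∧ ∀ a ∈ l, a.R M c (ν a.src) e) ↔ (∃ e, U M c e) ∧
      ∀ a ∈ l, ∀ b ∈ l, ∃ e, U M c e ∧ a.R M c (ν a.src) e ∧ b.R M c (ν b.src) e := by
  constructor
  · rintro ⟨e, hU, h⟩
    exact ⟨⟨e, hU⟩, fun a ha b hb => ⟨e, hU, h a ha, h b hb⟩⟩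
  · rintro ⟨⟨e₀, he₀⟩, h⟩
    let S : TameBranch P Sig C p → M.E → Prop := fun a e => U M c e ∧ a.R M c (ν a.src) e
    have hS : ∀ a ∈ l, ∃ m, S a m ∧ ∀ g, S a g → M.ple true m g := fun a ha => by
      obtain ⟨e, he, hea, -⟩ := h a ha a ha
      exact MSC.exists_min _ (fun e he => hp e he.1) ⟨e, he, hea⟩
    by_cases hl : ∃ a, a ∈ l
    · obtain ⟨a₀, ha₀⟩ := hl
      -- The common element is the latest of the least elements of the sets.
      obtain ⟨m, ⟨a, ha, hm, hmin⟩, hmax⟩ := MSC.exists_min (M := M) false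
        (S := fun m => ∃ a ∈ l, S a m ∧ ∀ g, S a g → M.ple true m g) (q := p)
        (fun m ⟨_, _, h, _⟩ => hp m h.1) ((hS a₀ ha₀).imp fun m hm => ⟨a₀, ha₀, hm⟩)
      refine ⟨m, hm.1, fun b hb => ?_⟩
      obtain ⟨m', hm', hmin'⟩ := hS b hb
      obtain ⟨z, hz, hza, hzb⟩ := h a ha b hb
      have h₁ : M.ple true m' m :=
        (MSC.ple_not (b := true)).1 (hmax m' ⟨b, hb, hm', hmin'⟩)
      have h₂ : M.ple true m z := hmin z ⟨hz, hza⟩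
      -- The set of `b` contains `m'` and `z` with `m' ≤ m ≤ z`. Since `m` has some preimage `x`
      -- under `b`, the lattice property puts `m` into the set too.
      obtain ⟨x, hx⟩ := hr m hm.1 b hb
      have hloc := (b.tame.loc hx).1.trans (b.tame.loc hzb).1.symm
      rcases MSC.ple_total (b := true) hloc with hxy | hxy
      · exact (b.tame.lattice hxy h₁ hx hm'.2).2
      · exact (b.tame.lattice hxy h₂ hzb hx).1
    · exact ⟨e₀, he₀, fun a ha => absurd ⟨a, ha⟩ hl⟩

namespace IsDNF

variable {Φ Ψ : ValuationPred P Sig C}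

theorem congr (hΦ : IsDNF Φ) (h : ∀ M c ν, Ψ M c ν ↔ Φ M c ν) : IsDNF Ψ := by
  obtain ⟨L, hL⟩ := hΦ
  exact ⟨L, fun M c ν => (h M c ν).trans (hL M c ν)⟩

theorem of_false : IsDNF (fun _ _ _ => False : ValuationPred P Sig C) := ⟨[], by simp⟩

theorem of_true : IsDNF (fun _ _ _ => True : ValuationPred P Sig C) := ⟨[[]], by simp⟩

theorem or (hΦ : IsDNF Φ) (hΨ : IsDNF Ψ) : IsDNF (fun M c ν => Φ M c ν ∨ Ψ M c ν) := by
  obtain ⟨L, hL⟩ := hΦ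
  obtain ⟨L', hL'⟩ := hΨ
  refine ⟨L ++ L', fun M c ν => ?_⟩
  simp only [hL, hL', List.mem_append, or_and_right, exists_or]

theorem and (hΦ : IsDNF Φ) (hΨ : IsDNF Ψ) : IsDNF (fun M c ν => Φ M c ν ∧ Ψ M c ν) := by
  obtain ⟨L, hL⟩ := hΦ
  obtain ⟨L', hL'⟩ := hΨ
  refine ⟨L.flatMap fun l => L'.map fun l' => l ++ l', fun M c ν => ?_⟩
  simp only [hL, hL', List.mem_flatMap, List.mem_map]
  constructor
  · rintro ⟨⟨l, hl, h⟩, l', hl', h'⟩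
    refine ⟨_, ⟨l, hl, l', hl', rfl⟩, fun a ha => ?_⟩
    exact (List.mem_append.1 ha).elim (h a) (h' a)
  · rintro ⟨_, ⟨l, hl, l', hl', rfl⟩, h⟩
    exact ⟨⟨l, hl, fun a ha => h a (List.mem_append_left _ ha)⟩,
      l', hl', fun a ha => h a (List.mem_append_right _ ha)⟩

theorem forall_mem {ι : Type v} {Φ : ι → ValuationPred P Sig C} (l : List ι)
    (h : ∀ i ∈ l, IsDNF (Φ i)) : IsDNF (fun M c ν => ∀ i ∈ l, Φ i M c ν) := by
  induction l with
  | nil => exact of_true.congr (by simp)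
  | cons a l ih => exact ((h a (by simp)).and (ih fun i hi => h i (by simp [hi]))).congr (by simp)

theorem exists_mem {ι : Type v} {Φ : ι → ValuationPred P Sig C} (l : List ι)
    (h : ∀ i ∈ l, IsDNF (Φ i)) : IsDNF (fun M c ν => ∃ i ∈ l, Φ i M c ν) := by
  induction l with
  | nil => exact of_false.congr (by simp)
  | cons a l ih => exact ((h a (by simp)).or (ih fun i hi => h i (by simp [hi]))).congr (by simp)

theorem exists_finite {ι : Type v} [Finite ι] {Φ : ι → ValuationPred P Sig C}
    (h : ∀ i, IsDNF (Φ i)) : IsDNF (fun M c ν => ∃ i, Φ i M c ν) := by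
  have := Fintype.ofFinite ι
  exact (exists_mem (Finset.univ : Finset ι).toList fun i _ => h i).congr (by simp)

theorem rel {p q : P} {R : EventRel P Sig C} (hR : R.Tame p q) (x y : ℕ) :
    IsDNF (fun M c ν => R M c (ν x) (ν y)) :=
  ⟨[[⟨x, y, p, q, R, hR⟩]], by simp [TameAtom.Holds]⟩

/-- In a conjunction, the statements about the event of variable `k`, located on process `p`, can
be separated. -/
theorem exists_split (k : ℕ) (p : P) (l : List (TameAtom P Sig C)) :
    ∃ (Θ : ValuationPred P Sig C) (U : EventPred P Sig C) (A : List (TameBranch P Sig C p)),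
      IsDNF Θ ∧ Trackable U ∧ ∀ (M : MSC P Sig) (c : M.E → C) (ν : ℕ → M.E) (e : M.E),
        M.loc e = p → ((∀ a ∈ l, a.Holds M c (Function.update ν k e)) ↔
          Θ M c ν ∧ U M c e ∧ ∀ a ∈ A, a.R M c (ν a.src) e) := by
  induction l with
  | nil => exact ⟨_, _, [], of_true, Trackable.const True, by simp⟩
  | cons a l ih =>
    obtain ⟨Θ, U, A, hΘ, hU, h⟩ := ih
    obtain ⟨x, y, p₁, p₂, R, hR⟩ := a
    -- An atom with `k` on both sides is a loop and goes to `U`; one with `k` on a single side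
    -- becomes a branch, reversed if `k` is the source, or is false if the process is wrong; the
    -- others go to `Θ`.
    by_cases hx : x = k <;> by_cases hy : y = k
    · subst hx hy
      refine ⟨Θ, _, A, hΘ, hR.trackable_diag.and hU, fun M c ν e he => ?_⟩
      rw [List.forall_mem_cons, h M c ν e he]
      simp only [TameAtom.Holds, Function.update_self]
      tauto
    · subst hx
      by_cases hp : p₁ = p
      · subst hp
        refine ⟨Θ, U, ⟨y, p₂, R.swap, hR.swap⟩ :: A, hΘ, hU, fun M c ν e he => ?_⟩
        rw [List.forall_mem_cons, h M c ν e he]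
        simp only [TameAtom.Holds, Function.update_self,
          Function.update_of_ne hy, List.forall_mem_cons]
        simp only [EventRel.swap]
        tauto
      · refine ⟨Θ, _, A, hΘ, Trackable.const False, fun M c ν e he => ?_⟩
        simp only [List.forall_mem_cons, TameAtom.Holds, Function.update_self]
        refine iff_of_false (fun h' => hp ((hR.loc h'.1).1.symm.trans he)) (by simp)
    · subst hy
      by_cases hp : p₂ = p
      · subst hp
        refine ⟨Θ, U, ⟨x, p₁, R, hR⟩ :: A, hΘ, hU, fun M c ν e he => ?_⟩
        rw [List.forall_mem_cons, h M c ν e he]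
        simp only [TameAtom.Holds, Function.update_self,
          Function.update_of_ne hx, List.forall_mem_cons]
        tauto
      · refine ⟨Θ, _, A, hΘ, Trackable.const False, fun M c ν e he => ?_⟩
        simp only [List.forall_mem_cons, TameAtom.Holds, Function.update_self]
        refine iff_of_false (fun h' => hp ((hR.loc h'.1).2.symm.trans he)) (by simp)
    · refine ⟨_, U, A, (rel hR x y).and hΘ, hU, fun M c ν e he => ?_⟩
      rw [List.forall_mem_cons, h M c ν e he]
      simp only [TameAtom.Holds, Function.update_of_ne hx,
        Function.update_of_ne hy]
      tauto

variable [Finite P]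

theorem unary {U : EventPred P Sig C} (hU : Trackable U) (x : ℕ) :
    IsDNF (fun M c ν => U M c (ν x)) :=
  (exists_finite fun p => rel (EventRel.Tame.test p hU) x x).congr fun M c ν => by simp

theorem not_rel {p q : P} {R : EventRel P Sig C} (hR : R.Tame p q) (x y : ℕ) :
    IsDNF (fun M c ν => ¬ R M c (ν x) (ν y)) :=
  ((unary (hR.dom id).not x).or ((unary (hR.swap.dom id).not y).or
    ((rel (hR.below true) x y).or (rel (hR.below false) x y)))).congr fun _ _ _ => hR.not_rel_iff

theorem not (hΦ : IsDNF Φ) : IsDNF (fun M c ν => ¬ Φ M c ν) := by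
  obtain ⟨L, hL⟩ := hΦ
  refine (forall_mem L fun l _ => exists_mem l fun a _ => not_rel a.tame a.src a.tgt).congr
    fun M c ν => ?_
  simp [hL, TameAtom.Holds]

/-- The candidates are restricted to the common range of all branches, as
`EventRel.exists_common_iff` requires. A common candidate of two branches is then the middle event
of a composition, and the quantifier disappears. -/
theorem exists_update (hΦ : IsDNF Φ) (k : ℕ) :
    IsDNF (fun M c ν => ∃ e, Φ M c (Function.update ν k e)) := by
  obtain ⟨L, hL⟩ := hΦ
  suffices H : ∀ (l : List (TameAtom P Sig C)) (p : P), IsDNF (fun M c ν => ∃ e, M.loc e = p ∧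
      ∀ a ∈ l, a.Holds M c (Function.update ν k e)) by
    refine (exists_mem L fun l _ => exists_finite fun p => H l p).congr fun M c ν => ?_
    simp only [hL]
    exact ⟨fun ⟨e, l, hl, h⟩ => ⟨l, hl, M.loc e, e, rfl, h⟩,
      fun ⟨l, hl, _, e, _, h⟩ => ⟨e, l, hl, h⟩⟩
  intro l p
  obtain ⟨Θ, U, A, hΘ, hU, h⟩ := exists_split k p l
  have hV : Trackable (fun M c e => (M.loc e = p ∧ U M c e) ∧ ∀ a ∈ A, ∃ x, a.R M c x e) :=
    ((Trackable.loc p).and hU).and (Trackable.forall_mem A fun a _ => a.tame.swap.dom id)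
  -- The existence of a candidate does not depend on any event; the variable `0` is arbitrary.
  refine (hΘ.and ((unary hV.exists_event 0).and (forall_mem A fun a _ => forall_mem A fun b _ =>
    rel ((a.tame.comp (EventRel.Tame.test p hV)).comp b.tame.swap) a.src b.src))).congr
      fun M c ν => ?_
  have := EventRel.exists_common_iff A (U := fun M c e => (M.loc e = p ∧ U M c e) ∧
    ∀ a ∈ A, ∃ x, a.R M c x e) (M := M) (c := c) (ν := ν) (fun e he => he.1.1) (fun e he => he.2)
  constructor
  · rintro ⟨e, he, hl⟩
    obtain ⟨h₁, h₂, h₃⟩ := (h M c ν e he).1 hl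
    obtain ⟨h₄, h₅⟩ := this.1 ⟨e, ⟨⟨he, h₂⟩, fun a ha => ⟨_, h₃ a ha⟩⟩, h₃⟩
    refine ⟨h₁, h₄, fun a ha b hb => ?_⟩
    obtain ⟨x, hx, hxa, hxb⟩ := h₅ a ha b hb
    exact ⟨x, ⟨x, hxa, rfl, hx.1.1, hx⟩, hxb⟩
  · rintro ⟨h₁, h₂, h₃⟩
    obtain ⟨e, he, h₄⟩ := this.2 ⟨h₂, fun a ha b hb => by
      obtain ⟨x, ⟨_, hxa, rfl, -, hx⟩, hxb⟩ := h₃ a ha b hb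
      exact ⟨_, hx, hxa, hxb⟩⟩
    exact ⟨e, he.1.1, (h M c ν e he.1.1).2 ⟨h₁, he.1.2, h₄⟩⟩

end IsDNF

theorem IsDNF.trackable_diag {Φ : ValuationPred P Sig C} (hΦ : IsDNF Φ) :
    Trackable (fun M c e => Φ M c fun _ => e) := by
  obtain ⟨L, hL⟩ := hΦ
  exact (Trackable.exists_mem L fun l _ => Trackable.forall_mem l fun a _ =>
    a.tame.trackable_diag).congr fun M c e => hL M c _

/-! ### Happened-before as a finite union of tame relations -/

/-- The events `e` and `f` are joined by a path that visits the given processes in this order. -/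
def pathRel (P Sig : Type u) (C : Type) : P → List P → EventRel P Sig C
  | p, [] => fun M _ e f => M.loc e = p ∧ M.ple true e f
  | p, q :: l => EventRel.comp (fun M _ e f => M.loc e = p ∧ M.ple true e f)
      (EventRel.comp (fun M _ e f => M.loc e = p ∧ M.loc f = q ∧ M.msg e f) (pathRel P Sig C q l))

theorem exists_tame_pathRel (p : P) (l : List P) : ∃ q, (pathRel P Sig C p l).Tame p q := by
  induction l generalizing p with
  | nil => exact ⟨p, EventRel.Tame.ple p⟩
  | cons q l ih =>
    obtain ⟨r, hr⟩ := ih q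
    exact ⟨r, (EventRel.Tame.ple p).comp ((EventRel.Tame.msg p q).comp hr)⟩

section pathRel

variable {M : MSC P Sig} {c : M.E → C} {p : P} {l : List P} {e f g : M.E}

theorem pathRel_loc (h : pathRel P Sig C p l M c e f) : M.loc e = p := by
  obtain ⟨q, hq⟩ := exists_tame_pathRel (Sig := Sig) (C := C) p l
  exact (hq.loc h).1

theorem le_of_pathRel (h : pathRel P Sig C p l M c e f) : M.le e f := by
  induction l generalizing p e with
  | nil => exact MSC.le_of_ple h.2
  | cons q l ih =>
    obtain ⟨x, hx, y, hy, h⟩ := h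
    exact ((MSC.le_of_ple hx.2).tail (Or.inr hy.2.2)).trans (ih h)

theorem pathRel_of_ple (h : M.ple true e g) (h' : pathRel P Sig C p l M c g f) :
    pathRel P Sig C p l M c e f := by
  have he := (MSC.ple_loc h).trans (pathRel_loc h')
  cases l with
  | nil => exact ⟨he, MSC.ple_trans h h'.2⟩
  | cons q l =>
    obtain ⟨x, hx, h'⟩ := h'
    exact ⟨x, ⟨he, MSC.ple_trans h hx.2⟩, h'⟩

theorem exists_pathRel_of_mem {q : P} (h : pathRel P Sig C q l M c e f) (hp : p ∈ q :: l) :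
    ∃ g l', M.le e g ∧ pathRel P Sig C p l' M c g f ∧ (p :: l').Sublist (q :: l) := by
  induction l generalizing q e with
  | nil =>
    obtain rfl := List.mem_singleton.1 hp
    exact ⟨e, [], Relation.ReflTransGen.refl, h, List.Sublist.refl _⟩
  | cons r l ih =>
    by_cases hpq : p = q
    · subst hpq
      exact ⟨e, r :: l, Relation.ReflTransGen.refl, h, List.Sublist.refl _⟩
    · obtain ⟨x, hx, y, hy, h⟩ := h
      obtain ⟨g, l', hg, h', hl⟩ := ih h ((List.mem_cons.1 hp).resolve_left hpq)
      exact ⟨g, l', ((MSC.le_of_ple hx.2).tail (Or.inr hy.2.2)).trans hg, h', hl.cons _⟩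

/-- Lists without repetition suffice, and there are finitely many of them. If a path starting with a
message edge from `e` comes back to the process of `e` in an event `g`, then by acyclicity `e`
precedes `g` on that process, and the detour is cut off. -/
theorem le_iff_exists_pathRel (c : M.E → C) :
    M.le e f ↔ ∃ l : {l : List P // l.Nodup}, ∃ p l', l.1 = p :: l' ∧
      pathRel P Sig C p l' M c e f := by
  constructor
  · intro h
    suffices H : ∃ p l, (p :: l).Nodup ∧ pathRel P Sig C p l M c e f by
      obtain ⟨p, l, hl, h⟩ := H
      exact ⟨⟨_, hl⟩, p, l, rfl, h⟩
    induction h using Relation.ReflTransGen.head_induction_on with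
    | refl => exact ⟨M.loc f, [], by simp, rfl, MSC.ple_refl f⟩
    | @head e x hex _ ih =>
      obtain ⟨q, l, hl, h⟩ := ih
      rcases hex with hex | hex
      · exact ⟨q, l, hl, pathRel_of_ple (MSC.plt_of_step (b := true) hex).1 h⟩
      · by_cases hmem : M.loc e ∈ q :: l
        · obtain ⟨g, l', hg, h', hl'⟩ := exists_pathRel_of_mem h hmem
          refine ⟨_, l', hl.sublist hl', pathRel_of_ple ?_ h'⟩
          have heg : M.le e g := Relation.ReflTransGen.head (Or.inr hex) hg
          rcases MSC.ple_total (b := true) (pathRel_loc h').symm with h₁ | h₁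
          · exact h₁
          · exact (MSC.le_antisymm heg (MSC.le_of_ple h₁)) ▸ MSC.ple_refl _
        · exact ⟨_, q :: l, List.nodup_cons.2 ⟨hmem, hl⟩, e, ⟨rfl, MSC.ple_refl _⟩, x,
            ⟨rfl, pathRel_loc h, hex⟩, h⟩
  · rintro ⟨-, p, l, -, h⟩
    exact le_of_pathRel h

end pathRel

/-! ### From formulas to local constraints -/

namespace MSO

variable [Finite P]

theorem isDNF_le (x y : ℕ) :
    IsDNF (fun M _ ν => M.le (ν x) (ν y) : ValuationPred P Sig C) := by
  classical
  have := Fintype.ofFinite P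
  refine (IsDNF.exists_finite (ι := {l : List P // l.Nodup}) (Φ := fun l M c ν =>
    ∃ p l', l.1 = p :: l' ∧ pathRel P Sig C p l' M c (ν x) (ν y)) fun ⟨l, hl⟩ => ?_).congr
      fun M c ν => le_iff_exists_pathRel c
  cases l with
  | nil => exact IsDNF.of_false.congr (by simp)
  | cons p l =>
    obtain ⟨q, hq⟩ := exists_tame_pathRel (Sig := Sig) (C := C) p l
    exact (IsDNF.rel hq x y).congr fun M c ν => by simp

/-- The valuation of the set variables that is coded by colours. -/
def colorSets {α : Type u} (c : α → ℕ → Prop) (X : ℕ) : Set α := {e | c e X}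

theorem isDNF_sat {φ : MSO P Sig} (hφ : φ.IsFO) :
    IsDNF (fun M c ν => Sat M ν (colorSets c) φ : ValuationPred P Sig (ℕ → Prop)) := by
  induction φ with
  | onProc p x => exact IsDNF.unary (Trackable.loc p) x
  | hasLab a x => exact IsDNF.unary (Trackable.node fun _ b _ => b = a) x
  | eq x y =>
    exact (IsDNF.exists_finite fun p =>
      IsDNF.rel (EventRel.Tame.test p (Trackable.const True)) x y).congr fun M c ν => by simp [Sat]
  | proc x y =>
    exact (IsDNF.exists_finite fun p => IsDNF.rel (EventRel.Tame.proc p) x y).congr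
      fun M c ν => by simp [Sat]
  | msg x y =>
    exact (IsDNF.exists_finite fun p => IsDNF.exists_finite fun q =>
      IsDNF.rel (EventRel.Tame.msg p q) x y).congr fun M c ν => by simp [Sat]
  | le x y => exact isDNF_le x y
  | mem x X => exact IsDNF.unary (Trackable.color fun s : ℕ → Prop => s X) x
  | or φ ψ ihφ ihψ => exact (ihφ hφ.1).or (ihψ hφ.2)
  | not φ ih => exact (ih hφ).not
  | exEvent x φ ih => exact (ih hφ).exists_update x
  | exSet X φ => exact hφ.elim

/-- A set quantifier is a projection of the colouring: the guessed set overwrites component `X`. The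
constant valuations reduce the normal form to loops; for sentences the choice of `e` is immaterial.
-/
theorem recognizable_sat {φ : MSO P Sig} (hφ : φ.IsEMSO) :
    Recognizable (fun M (c : M.E → ℕ → Prop) => ∃ e, Sat M (fun _ => e) (colorSets c) φ) := by
  induction hφ with
  | of_isFO h =>
    refine (isDNF_sat h).trackable_diag.exists_event.forall_recognizable.congr fun M c => ?_
    have := M.nonempty_E
    simp
  | exSet X h ih =>
    refine (Recognizable.proj (ih.comap fun x : (ℕ → Prop) × Prop =>
      Function.update x.1 X x.2)).congr fun M c => ?_
    have key : ∀ A : M.E → Prop, colorSets (fun e => Function.update (c e) X (A e)) =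
        Function.update (colorSets c) X {e | A e} := by
      intro A
      funext Y
      by_cases hY : Y = X
      · subst hY
        simp [colorSets]
      · simp [colorSets, hY]
    simp only [key, Sat]
    rw [exists_comm]
    exact ⟨fun ⟨A, e, h⟩ => ⟨{e | e ∈ A}, e, h⟩, fun ⟨A, e, h⟩ => ⟨{e | A e}, e, h⟩⟩

end MSO

end

/-! ### Local constraints and communicating machines -/

section

variable {P Sig : Type u}

/-- The action `α` agrees with the local system at an event with label `d`, where messages carry
the label of the send event. -/
def LocalSystem.ActionOk {C : Type w} (s : LocalSystem.{u, 0, w} P Sig C) {p : P} (d : s.D) :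
    CommAction P Sig (ULift.{u} s.D) p → Prop
  | .internal _ => s.internal d
  | .send _ m _ => m.down = d
  | .recv _ m _ => s.msg m.down d

/-- The machine that guesses a labelling and checks the constraints of a local system. -/
def LocalSystem.toCFM {C : Type w} (s : LocalSystem.{u, 0, w} P Sig C) (c : C) : CFM P Sig where
  Msg := ULift.{u} s.D
  finite_Msg := by
    have := s.finite_D
    infer_instance
  S _ := ULift.{u} (Option s.D)
  finite_S _ := by
    have := s.finite_D
    infer_instance
  -- A state is the label of the latest event of the process, and `none` before the first one.
  init _ := ⟨none⟩
  Δ p := {t | ∃ d, t.2.2.down = some d ∧ (t.1.down = none → s.first d) ∧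
    (∀ d₀, t.1.down = some d₀ → s.proc d₀ d) ∧ s.node p t.2.1.lab c d ∧ s.ActionOk d t.2.1}
  Acc := {σ | s.acc fun p => (σ p).down}

/-- An event lies on at most one message edge, so the chart and the labelling determine its action.
-/
theorem LocalSystem.exists_action {C : Type w} (s : LocalSystem.{u, 0, w} P Sig C) {M : MSC P Sig}
    {c : M.E → C} {d : M.E → s.D} (hd : s.Valid M c d) (p : P) (e : M.Ev p) :
    ∃ α : CommAction P Sig (ULift.{u} s.D) p, α.lab = M.lab e.1 ∧ s.ActionOk (d e.1) α ∧
      (M.IsInternal e.1 → ∃ a, α = .internal a) ∧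
      (∀ f, M.msg e.1 f → ∃ hq, α = .send (M.lab e.1) ⟨d e.1⟩ ⟨M.loc f, hq⟩) ∧
      ∀ f, M.msg f e.1 → ∃ hq, α = .recv (M.lab e.1) ⟨d f⟩ ⟨M.loc f, hq⟩ := by
  obtain ⟨e, rfl⟩ := e
  by_cases hi : M.IsInternal e
  · exact ⟨.internal (M.lab e), rfl, hd.internal e hi, fun _ => ⟨_, rfl⟩,
      fun f hf => absurd hf (hi f).1, fun f hf => absurd hf (hi f).2⟩
  · have hi' := hi
    simp only [MSC.IsInternal, not_forall, not_and_or, not_not] at hi'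
    obtain ⟨f, hf | hf⟩ := hi'
    · refine ⟨.send (M.lab e) ⟨d e⟩ ⟨M.loc f, (M.loc_ne_of_msg _ _ hf).symm⟩, rfl, rfl,
        fun h => absurd h hi, fun g hg => ?_, fun g hg => ?_⟩
      · obtain ⟨-, rfl⟩ := M.msg_unique _ _ _ _ hf hg (by simp)
        exact ⟨_, rfl⟩
      · obtain ⟨rfl, -⟩ := M.msg_unique _ _ _ _ hf hg (by simp)
        exact absurd rfl (M.loc_ne_of_msg _ _ hg)
    · refine ⟨.recv (M.lab e) ⟨d f⟩ ⟨M.loc f, M.loc_ne_of_msg _ _ hf⟩, rfl, hd.msg _ _ hf,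
        fun h => absurd h hi, fun g hg => ?_, fun g hg => ?_⟩
      · obtain ⟨rfl, -⟩ := M.msg_unique _ _ _ _ hf hg (by simp)
        exact absurd rfl (M.loc_ne_of_msg _ _ hf)
      · obtain ⟨rfl, -⟩ := M.msg_unique _ _ _ _ hf hg (by simp)
        exact ⟨_, rfl⟩

open Classical in
theorem LocalSystem.mem_language_toCFM {C : Type w} (s : LocalSystem.{u, 0, w} P Sig C) (c : C)
    (M : MSC P Sig) : M ∈ (s.toCFM c).language ↔ ∃ d, s.Valid M (fun _ => c) d := by
  constructor
  · rintro ⟨ρ, σ, hρ, hσ, hacc⟩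
    have hex : ∀ p (e : M.Ev p), ∃ d, (ρ p e).2.2.down = some d ∧
        ((ρ p e).1.down = none → s.first d) ∧ (∀ d₀, (ρ p e).1.down = some d₀ → s.proc d₀ d) ∧
        s.node p (ρ p e).2.1.lab c d ∧ s.ActionOk d (ρ p e).2.1 := hρ.mem_Δ
    choose d hd hfirst hproc hnode hact using hex
    have hd' : ∀ p (e : M.Ev p), d (M.loc e.1) ⟨e.1, rfl⟩ = d p e := by
      rintro p ⟨e, rfl⟩
      rfl
    refine ⟨fun e => d (M.loc e) ⟨e, rfl⟩, fun e => ?_, fun e he => ?_, fun e he => ?_,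
      fun e f hef => ?_, fun e f hef => ?_, ?_⟩
    · have := hnode _ ⟨e, rfl⟩
      rwa [hρ.lab_eq] at this
    · obtain ⟨a, ha⟩ := hρ.internal _ ⟨e, rfl⟩ he
      have := hact _ ⟨e, rfl⟩
      rwa [ha] at this
    · refine hfirst _ _ ?_
      rw [hρ.source_eq_init _ ⟨e, rfl⟩ he]
      rfl
    · have hl := M.loc_eq_of_proc _ _ hef
      have := hρ.target_eq_source (M.loc f) ⟨e, hl⟩ ⟨f, rfl⟩ hef
      refine hproc _ _ _ ?_
      rw [← this, hd, ← hd']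
    · obtain ⟨a, b, m, hq, hp, h₁, h₂⟩ := hρ.msg _ _ ⟨e, rfl⟩ ⟨f, rfl⟩ hef
      have h₃ := hact _ ⟨e, rfl⟩
      have h₄ := hact _ ⟨f, rfl⟩
      rw [h₁] at h₃
      rw [h₂] at h₄
      have h₃ : m.down = _ := h₃
      have h₄ : s.msg m.down _ := h₄
      rwa [h₃] at h₄
    · have hacc : s.acc fun p => (σ p).down := hacc
      convert hacc using 2 with p
      cases hl : M.last (fun e => d (M.loc e) ⟨e, rfl⟩) p with
      | none =>
        rw [MSC.last_eq_none_iff] at hl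
        rw [(hσ p).1 ⟨fun e => hl _ e.2⟩]
        rfl
      | some x =>
        obtain ⟨e, rfl, hlast, rfl⟩ := MSC.last_eq_some_iff.1 hl
        rw [(hσ _).2 ⟨e, rfl⟩ hlast, hd]
  · rintro ⟨d, hd⟩
    choose α hlab hact hint hsend hrecv using s.exists_action hd
    let src : M.E → Option s.D := fun e => if h : ∃ f, M.proc f e then some (d h.choose) else none
    have hsrc : ∀ e f, M.proc f e → src e = some (d f) := by
      intro e f h
      have hex : ∃ f, M.proc f e := ⟨f, h⟩
      simp only [src, dif_pos hex, MSC.proc_unique_left h hex.choose_spec]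
    have hsrc' : ∀ e, (∀ f, ¬ M.proc f e) → src e = none := by
      intro e h
      simp only [src, dif_neg (not_exists.2 h)]
    refine ⟨fun p e => (ULift.up (src e.1), α p e, ULift.up (some (d e.1))),
      fun p => ULift.up (M.last d p), ⟨fun p e => ?_,
      fun p e => hlab p e, fun p e he => ?_, fun p e f hef => ?_, fun p e he => hint p e he,
      ?_⟩, fun p => ⟨fun he => ?_, fun e he => ?_⟩, hd.acc⟩
    · refine ⟨d e.1, rfl, fun h => hd.first _ fun f hf => ?_, fun x hx => ?_, ?_, hact p e⟩
      · have h : src e.1 = none := h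
        rw [hsrc _ _ hf] at h
        cases h
      · have hx : src e.1 = some x := hx
        by_cases hex : ∃ f, M.proc f e.1
        · obtain ⟨f, hf⟩ := hex
          rw [hsrc _ _ hf] at hx
          cases hx
          exact hd.proc _ _ hf
        · rw [hsrc' _ (not_exists.1 hex)] at hx
          cases hx
      · obtain ⟨e, rfl⟩ := e
        simp only [hlab]
        exact hd.node e
    · exact congrArg ULift.up (hsrc' _ he)
    · exact congrArg ULift.up (hsrc _ _ hef).symm
    · rintro p q ⟨e, rfl⟩ ⟨f, rfl⟩ hef
      obtain ⟨hq, h₁⟩ := hsend _ ⟨e, rfl⟩ f hef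
      obtain ⟨hp, h₂⟩ := hrecv _ ⟨f, rfl⟩ e hef
      exact ⟨_, _, _, hq, hp, h₁, h₂⟩
    · exact congrArg ULift.up (MSC.last_eq_none_iff.2 fun e h => he.elim ⟨e, h⟩)
    · exact congrArg ULift.up (MSC.last_eq_some_iff.2 ⟨e.1, e.2, he, rfl⟩)

instance {Msg : Type u} [Finite P] [Finite Sig] [Finite Msg] (p : P) :
    Finite (CommAction P Sig Msg p) := by
  refine Finite.of_injective (β := Sig ⊕ Sig × Msg × {q : P // q ≠ p} ⊕
    Sig × Msg × {q : P // q ≠ p}) (fun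
      | .internal a => .inl a
      | .send a m q => .inr (.inl (a, m, q))
      | .recv a m q => .inr (.inr (a, m, q))) ?_
  rintro (_ | _ | _) (_ | _ | _) h <;> simp_all

/-- The local system whose labels are the transitions of a machine. -/
def CFM.toLocalSystem [Finite P] [Finite Sig] (A : CFM P Sig) :
    LocalSystem.{u, u, 0} P Sig PUnit where
  D := Σ p, A.S p × CommAction P Sig A.Msg p × A.S p
  finite_D := by
    have := A.finite_Msg
    have := A.finite_S
    infer_instance
  node p a _ d := d.1 = p ∧ d.2 ∈ A.Δ d.1 ∧ d.2.2.1.lab = a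
  internal d := ∃ a, d.2.2.1 = .internal a
  first d := d.2.1 = A.init d.1
  proc d d' := ∃ p x y, d = ⟨p, x⟩ ∧ d' = ⟨p, y⟩ ∧ x.2.2 = y.1
  msg d d' := ∃ (a b : Sig) (m : A.Msg) (hq : d'.1 ≠ d.1) (hp : d.1 ≠ d'.1),
    d.2.2.1 = .send a m ⟨d'.1, hq⟩ ∧ d'.2.2.1 = .recv b m ⟨d.1, hp⟩
  acc σ := ∃ t ∈ A.Acc, ∀ p, (σ p = none → t p = A.init p) ∧
    ∀ x, σ p = some ⟨p, x⟩ → t p = x.2.2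

theorem CFM.mem_language_iff [Finite P] [Finite Sig] (A : CFM P Sig) (M : MSC P Sig) :
    M ∈ A.language ↔ ∃ d, A.toLocalSystem.Valid M (fun _ => .unit) d := by
  constructor
  · rintro ⟨ρ, t, hρ, ht, hacc⟩
    have hcast : ∀ p (e : M.Ev p),
        (⟨M.loc e.1, ρ (M.loc e.1) ⟨e.1, rfl⟩⟩ : A.toLocalSystem.D) = ⟨p, ρ p e⟩ := by
      rintro p ⟨e, rfl⟩
      rfl
    refine ⟨fun e => ⟨M.loc e, ρ (M.loc e) ⟨e, rfl⟩⟩, fun e => ⟨rfl, hρ.mem_Δ _ _, hρ.lab_eq _ _⟩,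
      fun e he => hρ.internal _ ⟨e, rfl⟩ he, fun e he => hρ.source_eq_init _ ⟨e, rfl⟩ he,
      fun e f hef => ?_, fun e f hef => hρ.msg _ _ ⟨e, rfl⟩ ⟨f, rfl⟩ hef, t, hacc,
      fun p => ⟨fun h => ?_, fun x hx => ?_⟩⟩
    · have hl := M.loc_eq_of_proc _ _ hef
      exact ⟨M.loc f, _, _, hcast _ ⟨e, hl⟩, rfl, hρ.target_eq_source _ ⟨e, hl⟩ ⟨f, rfl⟩ hef⟩
    · exact (ht p).1 ⟨fun e => MSC.last_eq_none_iff.1 h _ e.2⟩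
    · obtain ⟨e, rfl, hlast, h⟩ := MSC.last_eq_some_iff.1 hx
      cases h
      exact (ht _).2 ⟨e, rfl⟩ hlast
  · rintro ⟨d, hd⟩
    have hex : ∀ p (e : M.Ev p), ∃ x, d e.1 = ⟨p, x⟩ := by
      rintro p ⟨e, rfl⟩
      have := (hd.node e).1
      generalize d e = y at this
      obtain ⟨q, y⟩ := y
      obtain rfl : q = M.loc e := this
      exact ⟨y, rfl⟩
    choose ρ hρ using hex
    obtain ⟨t, hacc, ht⟩ := hd.acc
    refine ⟨ρ, t, ⟨fun p e => ?_, fun p e => ?_, fun p e he => ?_, fun p e f hef => ?_,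
      fun p e he => ?_, fun p q e f hef => ?_⟩, fun p => ⟨fun he => ?_, fun e he => ?_⟩, hacc⟩
    · have := (hd.node e.1).2.1
      rwa [hρ p e] at this
    · have := (hd.node e.1).2.2
      rwa [hρ p e] at this
    · have := hd.first e.1 he
      rwa [hρ p e] at this
    · obtain ⟨q, x, y, hx, hy, h⟩ := hd.proc _ _ hef
      rw [hρ p e] at hx
      rw [hρ p f] at hy
      cases hx
      cases hy
      exact h
    · have := hd.internal e.1 he
      rwa [hρ p e] at this
    · have := hd.msg _ _ hef
      rwa [hρ p e, hρ q f] at this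
    · exact (ht p).1 (MSC.last_eq_none_iff.2 fun e h => he.elim ⟨e, h⟩)
    · exact (ht p).2 _ (MSC.last_eq_some_iff.2 ⟨e.1, e.2, he, hρ p e⟩)

/-! ### Local constraints as existential formulas -/

namespace MSO

theorem sat_congr {M : MSC P Sig} (φ : MSO P Sig) {ν ν' : ℕ → M.E} {μ μ' : ℕ → Set M.E}
    (hν : ∀ x ∈ φ.freeEvent, ν x = ν' x) (hμ : ∀ X ∈ φ.freeSet, μ X = μ' X) :
    Sat M ν μ φ ↔ Sat M ν' μ' φ := by
  induction φ generalizing ν ν' μ μ' with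
  | onProc p x => simp [Sat, hν x (by simp [freeEvent])]
  | hasLab a x => simp [Sat, hν x (by simp [freeEvent])]
  | eq x y => simp [Sat, hν x (by simp [freeEvent]), hν y (by simp [freeEvent])]
  | proc x y => simp [Sat, hν x (by simp [freeEvent]), hν y (by simp [freeEvent])]
  | msg x y => simp [Sat, hν x (by simp [freeEvent]), hν y (by simp [freeEvent])]
  | le x y => simp [Sat, hν x (by simp [freeEvent]), hν y (by simp [freeEvent])]
  | mem x X => simp [Sat, hν x (by simp [freeEvent]), hμ X (by simp [freeSet])]
  | or φ ψ ihφ ihψ =>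
    exact or_congr
      (ihφ (fun x hx => hν x (Or.inl hx)) (fun x hx => hμ x (Or.inl hx)))
      (ihψ (fun x hx => hν x (Or.inr hx)) (fun x hx => hμ x (Or.inr hx)))
  | not φ ih => exact not_congr (ih hν hμ)
  | exEvent x φ ih =>
    refine exists_congr fun e => ih (fun y hy => ?_) hμ
    by_cases h : y = x
    · simp [h]
    · simp [h, hν y ⟨hy, h⟩]
  | exSet X φ ih =>
    refine exists_congr fun A => ih hν (fun Y hY => ?_)
    by_cases h : Y = X
    · simp [h]
    · simp [h, hμ Y ⟨hY, h⟩]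

theorem finite_freeEvent (φ : MSO P Sig) : φ.freeEvent.Finite := by
  induction φ with
  | or φ ψ ihφ ihψ => exact ihφ.union ihψ
  | not φ ih => exact ih
  | exEvent x φ ih => exact ih.subset Set.sdiff_subset
  | exSet X φ ih => exact ih
  | _ => simp [freeEvent]

theorem finite_freeSet (φ : MSO P Sig) : φ.freeSet.Finite := by
  induction φ with
  | or φ ψ ihφ ihψ => exact ihφ.union ihψ
  | not φ ih => exact ih
  | exEvent x φ ih => exact ih
  | exSet X φ ih => exact ih.subset Set.sdiff_subset
  | _ => simp [freeSet]

theorem exists_exEvent_closure {φ : MSO P Sig} (hφ : φ.IsFO) (s : Finset ℕ) :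
    ∃ ψ : MSO P Sig, ψ.IsFO ∧ ψ.freeEvent = φ.freeEvent \ s ∧ ψ.freeSet = φ.freeSet ∧
      ∀ (M : MSC P Sig) (ν : ℕ → M.E) μ, Sat M ν μ ψ ↔
        ∃ ν' : ℕ → M.E, (∀ x ∉ s, ν' x = ν x) ∧ Sat M ν' μ φ := by
  classical
  induction s using Finset.induction with
  | empty =>
    refine ⟨φ, hφ, by simp, rfl, fun M ν μ => ⟨fun h => ⟨ν, by simp, h⟩, ?_⟩⟩
    rintro ⟨ν', h, h'⟩
    obtain rfl : ν' = ν := funext fun x => h x (by simp)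
    exact h'
  | insert x s hx ih =>
    obtain ⟨ψ, h₁, h₂, h₃, h₄⟩ := ih
    refine ⟨exEvent x ψ, h₁, ?_, h₃, fun M ν μ => ?_⟩
    · simp only [freeEvent, h₂, Finset.coe_insert]
      ext y
      simp
      tauto
    · simp only [Sat, h₄]
      constructor
      · rintro ⟨e, ν', h, h'⟩
        refine ⟨ν', fun y hy => ?_, h'⟩
        simp only [Finset.mem_insert, not_or] at hy
        rw [h y hy.2, Function.update_of_ne hy.1]
      · rintro ⟨ν', h, h'⟩
        refine ⟨ν' x, ν', fun y hy => ?_, h'⟩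
        by_cases hyx : y = x
        · simp [hyx]
        · rw [Function.update_of_ne hyx, h y (by simp [hyx, hy])]

theorem exists_exSet_closure {φ : MSO P Sig} (hφ : φ.IsEMSO) (s : Finset ℕ) :
    ∃ ψ : MSO P Sig, ψ.IsEMSO ∧ ψ.freeEvent = φ.freeEvent ∧ ψ.freeSet = φ.freeSet \ s ∧
      ∀ (M : MSC P Sig) (ν : ℕ → M.E) μ, Sat M ν μ ψ ↔
        ∃ μ' : ℕ → Set M.E, (∀ X ∉ s, μ' X = μ X) ∧ Sat M ν μ' φ := by
  classical
  induction s using Finset.induction with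
  | empty =>
    refine ⟨φ, hφ, rfl, by simp, fun M ν μ => ⟨fun h => ⟨μ, by simp, h⟩, ?_⟩⟩
    rintro ⟨μ', h, h'⟩
    obtain rfl : μ' = μ := funext fun x => h x (by simp)
    exact h'
  | insert X s hX ih =>
    obtain ⟨ψ, h₁, h₂, h₃, h₄⟩ := ih
    refine ⟨exSet X ψ, h₁.exSet X, h₂, ?_, fun M ν μ => ?_⟩
    · simp only [freeSet, h₃, Finset.coe_insert]
      ext y
      simp
      tauto
    · simp only [Sat, h₄]
      constructor
      · rintro ⟨e, μ', h, h'⟩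
        refine ⟨μ', fun y hy => ?_, h'⟩
        simp only [Finset.mem_insert, not_or] at hy
        rw [h y hy.2, Function.update_of_ne hy.1]
      · rintro ⟨μ', h, h'⟩
        refine ⟨μ' X, μ', fun y hy => ?_, h'⟩
        by_cases hyx : y = X
        · simp [hyx]
        · rw [Function.update_of_ne hyx, h y (by simp [hyx, hy])]

/-- The event variables are quantified first, because in an existential formula the set quantifiers
must stand outside. -/
theorem exists_sentence {φ : MSO P Sig} (hφ : φ.IsFO) :
    ∃ ψ : MSO P Sig, ψ.IsEMSO ∧ ψ.IsSentence ∧ ∀ (M : MSC P Sig) (ν : ℕ → M.E) μ,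
      Sat M ν μ ψ ↔ ∃ ν' μ', Sat M ν' μ' φ := by
  classical
  obtain ⟨ψ, h₁, h₂, h₃, h₄⟩ := exists_exEvent_closure hφ φ.finite_freeEvent.toFinset
  obtain ⟨χ, h₅, h₆, h₇, h₈⟩ :=
    exists_exSet_closure (IsEMSO.of_isFO h₁) φ.finite_freeSet.toFinset
  refine ⟨χ, h₅, ⟨by simp [h₆, h₂], by simp [h₇, h₃]⟩, fun M ν μ => ?_⟩
  rw [h₈]
  simp only [h₄, Set.Finite.mem_toFinset]
  constructor
  · rintro ⟨μ', -, ν', -, h⟩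
    exact ⟨ν', μ', h⟩
  · rintro ⟨ν', μ', h⟩
    refine ⟨fun X => if X ∈ φ.freeSet then μ' X else μ X, fun X hX => by simp [hX],
      fun x => if x ∈ φ.freeEvent then ν' x else ν x, fun x hx => by simp [hx], ?_⟩
    refine (sat_congr φ (fun x hx => ?_) fun X hX => ?_).1 h <;> simp [*]

/-- Properties of valuations that are expressed by a first-order formula. -/
def FODefinable (Φ : ∀ M : MSC P Sig, (ℕ → M.E) → (ℕ → Set M.E) → Prop) : Prop :=
  ∃ φ : MSO P Sig, φ.IsFO ∧ ∀ M ν μ, Sat M ν μ φ ↔ Φ M ν μ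

namespace FODefinable

variable {Φ Ψ : ∀ M : MSC P Sig, (ℕ → M.E) → (ℕ → Set M.E) → Prop}

theorem congr (hΦ : FODefinable Φ) (h : ∀ M ν μ, Ψ M ν μ ↔ Φ M ν μ) : FODefinable Ψ := by
  obtain ⟨φ, hφ, h'⟩ := hΦ
  exact ⟨φ, hφ, fun M ν μ => (h' M ν μ).trans (h M ν μ).symm⟩

theorem not (hΦ : FODefinable Φ) : FODefinable (fun M ν μ => ¬ Φ M ν μ) := by
  obtain ⟨φ, hφ, h⟩ := hΦ
  exact ⟨φ.not, hφ, fun M ν μ => not_congr (h M ν μ)⟩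

theorem or (hΦ : FODefinable Φ) (hΨ : FODefinable Ψ) :
    FODefinable (fun M ν μ => Φ M ν μ ∨ Ψ M ν μ) := by
  obtain ⟨φ, hφ, h⟩ := hΦ
  obtain ⟨ψ, hψ, h'⟩ := hΨ
  exact ⟨φ.or ψ, ⟨hφ, hψ⟩, fun M ν μ => or_congr (h M ν μ) (h' M ν μ)⟩

theorem and (hΦ : FODefinable Φ) (hΨ : FODefinable Ψ) :
    FODefinable (fun M ν μ => Φ M ν μ ∧ Ψ M ν μ) :=
  (hΦ.not.or hΨ.not).not.congr fun _ _ _ => by tauto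

theorem imp (hΦ : FODefinable Φ) (hΨ : FODefinable Ψ) :
    FODefinable (fun M ν μ => Φ M ν μ → Ψ M ν μ) :=
  (hΦ.not.or hΨ).congr fun _ _ _ => by tauto

theorem const (q : Prop) : FODefinable (fun (_ : MSC P Sig) _ _ => q) := by
  by_cases hq : q
  -- A truth constant needs an atom and so leaves the variable `0` free; `exists_sentence` closes
  -- the formula afterwards.
  · exact ⟨.eq 0 0, trivial, by simp [hq, Sat]⟩
  · exact ⟨.not (.eq 0 0), trivial, by simp [hq, Sat]⟩

theorem ex (x : ℕ) (hΦ : FODefinable Φ) :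
    FODefinable (fun M ν μ => ∃ e, Φ M (Function.update ν x e) μ) := by
  obtain ⟨φ, hφ, h⟩ := hΦ
  exact ⟨.exEvent x φ, hφ, fun M ν μ => exists_congr fun e => h M _ μ⟩

theorem all (x : ℕ) (hΦ : FODefinable Φ) :
    FODefinable (fun M ν μ => ∀ e, Φ M (Function.update ν x e) μ) :=
  (hΦ.not.ex x).not.congr fun _ _ _ => by simp

theorem exists_mem {ι : Type v} {Φ : ι → ∀ M : MSC P Sig, (ℕ → M.E) → (ℕ → Set M.E) → Prop}
    (l : List ι) (h : ∀ i, FODefinable (Φ i)) : FODefinable (fun M ν μ => ∃ i ∈ l, Φ i M ν μ) := by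
  induction l with
  | nil => exact (const False).congr (by simp)
  | cons a l ih => exact ((h a).or ih).congr (by simp)

theorem exists_finite {ι : Type v} [Finite ι]
    {Φ : ι → ∀ M : MSC P Sig, (ℕ → M.E) → (ℕ → Set M.E) → Prop}
    (h : ∀ i, FODefinable (Φ i)) : FODefinable (fun M ν μ => ∃ i, Φ i M ν μ) := by
  have := Fintype.ofFinite ι
  exact (exists_mem (Finset.univ : Finset ι).toList h).congr (by simp)

theorem forall_finite {ι : Type v} [Finite ι]
    {Φ : ι → ∀ M : MSC P Sig, (ℕ → M.E) → (ℕ → Set M.E) → Prop}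
    (h : ∀ i, FODefinable (Φ i)) : FODefinable (fun M ν μ => ∀ i, Φ i M ν μ) :=
  (exists_finite fun i => (h i).not).not.congr fun _ _ _ => by simp

theorem loc (x : ℕ) (p : P) : FODefinable (fun (M : MSC P Sig) ν _ => M.loc (ν x) = p) :=
  ⟨.onProc p x, trivial, fun _ _ _ => Iff.rfl⟩

theorem lab (x : ℕ) (a : Sig) : FODefinable (fun (M : MSC P Sig) ν _ => M.lab (ν x) = a) :=
  ⟨.hasLab a x, trivial, fun _ _ _ => Iff.rfl⟩

theorem proc (x y : ℕ) : FODefinable (fun (M : MSC P Sig) ν _ => M.proc (ν x) (ν y)) :=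
  ⟨.proc x y, trivial, fun _ _ _ => Iff.rfl⟩

theorem msg (x y : ℕ) : FODefinable (fun (M : MSC P Sig) ν _ => M.msg (ν x) (ν y)) :=
  ⟨.msg x y, trivial, fun _ _ _ => Iff.rfl⟩

theorem mem (x X : ℕ) : FODefinable (fun (_ : MSC P Sig) ν μ => ν x ∈ μ X) :=
  ⟨.mem x X, trivial, fun _ _ _ => Iff.rfl⟩

end FODefinable

end MSO

open MSO in
/-- The labellings that satisfy a local system, coded by one set variable for each label, are
first-order definable. -/
theorem LocalSystem.foDefinable_valid [Finite P] [Finite Sig]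
    (s : LocalSystem.{u, u, 0} P Sig PUnit) :
    ∃ k : s.D → ℕ, Function.Injective k ∧ FODefinable (fun M _ μ =>
      ∃ d : M.E → s.D, (∀ e x, e ∈ μ (k x) ↔ d e = x) ∧ s.Valid M (fun _ => .unit) d) := by
  have := s.finite_D
  obtain ⟨n, ⟨k⟩⟩ := Finite.exists_equiv_fin s.D
  refine ⟨fun x => k x, fun x y h => k.injective (Fin.ext h), ?_⟩
  have mem := fun (i : ℕ) (x : s.D) => FODefinable.mem (P := P) (Sig := Sig) i (k x)
  -- The sets coding the labels partition the events.
  have hlab := (FODefinable.exists_finite fun x : s.D => FODefinable.forall_finite fun y : s.D =>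
    ((mem 0 y).imp (.const (x = y))).and ((FODefinable.const (x = y)).imp (mem 0 y))).all 0
  have hnode := (FODefinable.forall_finite fun x : s.D => (mem 0 x).imp
    (.exists_finite fun p => .exists_finite fun a => (FODefinable.const (s.node p a .unit x)).and
      ((FODefinable.loc 0 p).and (.lab 0 a)))).all 0
  have hinternal := (FODefinable.forall_finite fun x : s.D => (mem 0 x).imp
    (((((FODefinable.msg 0 1).or (.msg 1 0)).ex 1).not).imp (.const (s.internal x)))).all 0
  have hfirst := (FODefinable.forall_finite fun x : s.D => (mem 0 x).imp
    ((((FODefinable.proc 1 0).ex 1).not).imp (.const (s.first x)))).all 0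
  have hproc := ((FODefinable.forall_finite fun x : s.D => (mem 0 x).imp
    (.forall_finite fun y : s.D => (mem 1 y).imp
      ((FODefinable.proc 0 1).imp (.const (s.proc x y))))).all 1).all 0
  have hmsg := ((FODefinable.forall_finite fun x : s.D => (mem 0 x).imp
    (.forall_finite fun y : s.D => (mem 1 y).imp
      ((FODefinable.msg 0 1).imp (.const (s.msg x y))))).all 1).all 0
  -- There are finitely many families of final labels, so acceptance is a finite disjunction over
  -- the admissible ones.
  have hacc := FODefinable.exists_finite fun σ : P → Option s.D =>
    (FODefinable.const (s.acc σ)).and (.forall_finite fun p =>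
      ((FODefinable.const (σ p = none)).imp ((FODefinable.loc 0 p).not.all 0)).and
      (.forall_finite fun x : s.D => (FODefinable.const (σ p = some x)).imp
        (((FODefinable.loc 0 p).and ((((FODefinable.proc 0 1).ex 1).not).and (mem 0 x))).ex 0)))
  refine (hlab.and (hnode.and (hinternal.and (hfirst.and (hproc.and (hmsg.and hacc)))))).congr
    fun M ν μ => ?_
  simp only [Function.update_self, ne_eq, zero_ne_one, not_false_eq_true,
    Function.update_of_ne]
  constructor
  · rintro ⟨d, hd, hv⟩
    simp only [hd]
    refine ⟨fun e => ⟨d e, fun x => ⟨id, id⟩⟩, ?_, ?_, ?_, ?_, ?_, M.last d, hv.acc, fun p =>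
      ⟨MSC.last_eq_none_iff.1, fun x hx => ?_⟩⟩
    · rintro e _ rfl
      exact ⟨_, _, hv.node e, rfl, rfl⟩
    · rintro e _ rfl h
      exact hv.internal e fun f => ⟨fun hf => h ⟨f, Or.inl hf⟩, fun hf => h ⟨f, Or.inr hf⟩⟩
    · rintro e _ rfl h
      exact hv.first e (not_exists.1 h)
    · rintro e f _ rfl _ rfl h
      exact hv.proc e f h
    · rintro e f _ rfl _ rfl h
      exact hv.msg e f h
    · obtain ⟨e, he, hl, h⟩ := MSC.last_eq_some_iff.1 hx
      exact ⟨e, he, not_exists.2 hl, h⟩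
  · rintro ⟨h₁, h₂, h₃, h₄, h₅, h₆, σ, hσ, h₇⟩
    choose d hd using h₁
    have hd' : ∀ e x, e ∈ μ (k x) ↔ d e = x := fun e x => ⟨(hd e x).1, (hd e x).2⟩
    simp only [hd'] at h₂ h₃ h₄ h₅ h₆ h₇
    refine ⟨d, hd', fun e => ?_, fun e he => ?_, fun e he => h₄ e _ rfl (not_exists.2 he),
      fun e f h => h₅ e f _ rfl _ rfl h, fun e f h => h₆ e f _ rfl _ rfl h, ?_⟩
    · obtain ⟨p, a, h, rfl, rfl⟩ := h₂ e _ rfl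
      exact h
    · refine h₃ e _ rfl ?_
      rintro ⟨f, hf | hf⟩
      exacts [(he f).1 hf, (he f).2 hf]
    · have hlast : M.last d = σ := by
        funext p
        cases hp : σ p with
        | none => exact MSC.last_eq_none_iff.2 ((h₇ p).1 hp)
        | some x =>
          obtain ⟨e, he, hl, hx⟩ := (h₇ p).2 x hp
          exact MSC.last_eq_some_iff.2 ⟨e, he, not_exists.1 hl, hx⟩
      rwa [hlast]

end

/-! ### The two inclusions -/

theorem emsoLanguages_subset_cfmLanguages (P Sig : Type u) [Finite P] :
    emsoLanguages P Sig ⊆ cfmLanguages P Sig := by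
  rintro _ ⟨φ, hφ, hs, rfl⟩
  obtain ⟨s, h⟩ := MSO.recognizable_sat hφ
  -- A sentence has no free set variables, so any constant colouring will do.
  refine ⟨s.toCFM fun _ => False, Set.ext fun M => ?_⟩
  rw [s.mem_language_toCFM, ← h]
  have hinv : ∀ (ν ν' : ℕ → M.E) μ μ', MSO.Sat M ν μ φ → MSO.Sat M ν' μ' φ := fun ν ν' μ μ' =>
    (MSO.sat_congr φ (by simp [hs.1]) (by simp [hs.2])).1
  obtain ⟨e⟩ := M.nonempty_E
  exact ⟨fun ⟨e, he⟩ ν μ => hinv _ _ _ _ he, fun hM => ⟨e, hM _ _⟩⟩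

theorem cfmLanguages_subset_emsoLanguages (P Sig : Type u) [Finite P] [Finite Sig] :
    cfmLanguages P Sig ⊆ emsoLanguages P Sig := by
  rintro _ ⟨A, rfl⟩
  obtain ⟨k, hk, φ, hφ, h⟩ := A.toLocalSystem.foDefinable_valid
  obtain ⟨ψ, hψ, hs, h'⟩ := MSO.exists_sentence hφ
  refine ⟨ψ, hψ, hs, Set.ext fun M => ?_⟩
  have hM : M ∈ A.language ↔ ∃ (ν : ℕ → M.E) (μ : ℕ → Set M.E), MSO.Sat M ν μ φ := by
    simp only [A.mem_language_iff, h]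
    obtain ⟨e⟩ := M.nonempty_E
    constructor
    · rintro ⟨d, hd⟩
      exact ⟨fun _ => e, fun i => {e | k (d e) = i}, d, fun e x => hk.eq_iff, hd⟩
    · rintro ⟨-, -, d, -, hd⟩
      exact ⟨d, hd⟩
  obtain ⟨e⟩ := M.nonempty_E
  rw [hM]
  exact ⟨fun H => (h' M _ _).1 (H (fun _ => e) fun _ => ∅), fun H ν μ => (h' M ν μ).2 H⟩

theorem theorem1 (P Sig : Type u) [Finite P] [Nonempty P] [Finite Sig] [Nonempty Sig] :
    emsoLanguages P Sig = cfmLanguages P Sig :=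
  (emsoLanguages_subset_cfmLanguages P Sig).antisymm (cfmLanguages_subset_emsoLanguages P Sig)
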